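/- Write $M_k$ for the algebra of complex $k\times k$ matrices. A linear map $M_p\to M_m$ is called a PPT map if it is completely positive and its composition with the transposition of $M_m$ is also completely positive (trace preservation is not required). States need not be normalized: a bipartite state is a positive semidefinite matrix. A positive semidefinite matrix in $M_n\otimes M_p$ has Schmidt number at most two if it is a finite sum of matrices $|a\rangle\langle a|$ in which each vector $a\in\mathbb C^n\otimes\mathbb C^p$ has Schmidt rank at most two; a matrix in $M_n\otimes M_m$ is separable if it is a finite sum $\sum_i A_i\otimes B_i$ with all $A_i\in M_n$ and $B_i\in M_m$ positive semidefinite. Theorem. Let $\varphi=\sum_j\varphi_j$ be a finite sum of PPT maps $\varphi_j:M_p\to M_m$, each of which takes its values in a $3\times 3$ block: for every $j$ there is an orthogonal projection $P_j\in M_m$ of rank at most three with $\varphi_j(X)=P_j\varphi_j(X)P_j$ for all $X\in M_p$ (for $m=3$ this is no restriction). Let $\varphi':M_q\to M_p$ be a PPT map and let $\rho\in M_n\otimes M_q$ be a bipartite state such that $(I_n\otimes\varphi')(\rho)$ has Schmidt number at most two. Then $(I_n\otimes(\varphi\circ\varphi'))(\rho)$ is separable. -/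

import Mathlib

open scoped Kronecker ComplexOrder

namespace PPTSquare

/-- The ampliation `id_k ⊗ φ`, acting on block matrices with `k × k` blocks: `φ` is applied to
each block `(X (i, ·) (j, ·))`. -/
def ampliation {k p q : Type*}
    (φ : Matrix p p ℂ →ₗ[ℂ] Matrix q q ℂ) :
    Matrix (k × p) (k × p) ℂ →ₗ[ℂ] Matrix (k × q) (k × q) ℂ where
  toFun X := Matrix.of fun u v => φ (Matrix.of fun c d => X (u.1, c) (v.1, d)) u.2 v.2
  map_add' X Y := by
    ext u v
    exact congrFun (congrFun (φ.map_add (Matrix.of fun c d => X (u.1, c) (v.1, d))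
      (Matrix.of fun c d => Y (u.1, c) (v.1, d))) u.2) v.2
  map_smul' a X := by
    ext u v
    exact congrFun (congrFun (φ.map_smul a (Matrix.of fun c d => X (u.1, c) (v.1, d))) u.2) v.2

/-- Complete positivity: `id_k ⊗ φ` preserves positive semidefiniteness for every `k`. -/
def IsCompletelyPositive {p q : Type*} (φ : Matrix p p ℂ →ₗ[ℂ] Matrix q q ℂ) : Prop :=
  ∀ (k : ℕ) (X : Matrix (Fin k × p) (Fin k × p) ℂ), X.PosSemidef → (ampliation φ X).PosSemidef

/-- Complete copositivity: transposition after `φ` is completely positive. -/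
def IsCompletelyCopositive {p q : Type*} (φ : Matrix p p ℂ →ₗ[ℂ] Matrix q q ℂ) : Prop :=
  IsCompletelyPositive ((Matrix.transposeLinearEquiv q q ℂ ℂ).toLinearMap ∘ₗ φ)

/-- A PPT map is completely positive and completely copositive. -/
def IsPPTMap {p q : Type*} (φ : Matrix p p ℂ →ₗ[ℂ] Matrix q q ℂ) : Prop :=
  IsCompletelyPositive φ ∧ IsCompletelyCopositive φ

/-- All values of `φ` live on the `d × d` block of some subspace of dimension at most `d`:
`P` is the orthogonal projection onto that subspace. -/
def MapsIntoBlock {p q : Type*} [Fintype q] (d : ℕ)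
    (φ : Matrix p p ℂ →ₗ[ℂ] Matrix q q ℂ) : Prop :=
  ∃ P : Matrix q q ℂ, IsStarProjection P ∧ P.rank ≤ d ∧ ∀ X, φ X = P * φ X * P

/-- The Schmidt rank of a bipartite vector: the rank of its coefficient matrix. -/
noncomputable def schmidtRank {m n : Type*} [Fintype n] (a : m × n → ℂ) : ℕ :=
  (Matrix.of fun (i : m) (j : n) => a (i, j)).rank

/-- The (possibly unnormalized) bipartite state `σ` has Schmidt number at most `r`: it is a finite
sum of rank-one matrices `|a⟩⟨a|` with each `a` of Schmidt rank at most `r`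
(probability weights are absorbed into the vectors). -/
def SchmidtNumberLE {m n : Type*} [Fintype n] (r : ℕ) (σ : Matrix (m × n) (m × n) ℂ) : Prop :=
  ∃ (N : ℕ) (a : Fin N → m × n → ℂ), (∀ i, schmidtRank (a i) ≤ r) ∧
    σ = ∑ i, Matrix.vecMulVec (a i) (star (a i))

/-- The (possibly unnormalized) bipartite state `σ` is separable: it is a finite sum of products
of positive semidefinite matrices. -/
def IsSeparable {m n : Type*} (σ : Matrix (m × n) (m × n) ℂ) : Prop :=
  ∃ (N : ℕ) (A : Fin N → Matrix m m ℂ) (B : Fin N → Matrix n n ℂ),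
    (∀ i, (A i).PosSemidef) ∧ (∀ i, (B i).PosSemidef) ∧ σ = ∑ i, A i ⊗ₖ B i

end PPTSquare

/-! A vector of Schmidt rank at most two lives in `ℂ² ⊗ ℂᵖ` after a local change of basis, and a map
with values in a `3 × 3` block sends its projection to a PPT operator on `ℂ² ⊗ ℂ³`. Everything
therefore reduces to the theorem of Størmer and Woronowicz, `IsPPT.mem_sepCone`: PPT operators on
`ℂ² ⊗ ℂᴺ` with `N ≤ 3` are separable. Operators on `ℂ² ⊗ ℂᴺ` are written as block matrices
`[[A, B], [Bᴴ, C]]`, so that partial transposition exchanges `B` and `Bᴴ`.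

The proof is by induction on `N` and on the total rank `r + s`, where `r` and `s` are the ranks of
`ρ` and of its partial transpose.

* If `r² + s² > 4 N² + 1`, a dimension count shows that `ρ` is not an extreme point of the PPT cone,
  and moving from `ρ` to the boundary in two opposite directions writes it as a sum of two PPT
  operators of smaller total rank (`IsPPT.exists_add_of_rank_large`).
* If `A` is singular, `ρ` is a product operator plus a PPT operator on a space with smaller `N`
  (`IsPPT.mem_sepCone_of_mulVec_eq_zero`).
* Otherwise a local operator turns `A` into `1`. The Schur complements `C - BᴴB` and `C - BBᴴ` are
  positive semidefinite of equal trace and of ranks `r - N` and `s - N`. If they vanish, `B` is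
  normal, and its spectral decomposition gives product vectors
  (`fromBlocks_mem_sepCone_of_normal`). If not, the bound on `r² + s²` leaves `N = 3` and both
  complements of rank one, `u u*` and `v v*`. When `u` and `v` are dependent, `B` is again normal.
  When they are independent, `B` has a normal completion of size four whose compression is `ρ`
  (`exists_normal_completion`). Its existence rests on trace identities for the self-commutator
  `BᴴB - BBᴴ = v v* - u u*`, which are strong enough precisely because `u` and `v` have a
  one-dimensional orthogonal complement.
-/

namespace PPTSquare

open Matrix MatrixOrder

variable {m n k p : Type*}

/-! ### Block matrices as operators on a qubit tensored with another system -/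

/-- Partial transposition on the qubit factor, for operators on `ℂ² ⊗ ℂⁿ` written as `2 × 2` block
matrices: the two off-diagonal blocks are exchanged. -/
def blockTranspose (ρ : Matrix (n ⊕ n) (n ⊕ n) ℂ) : Matrix (n ⊕ n) (n ⊕ n) ℂ :=
  fromBlocks ρ.toBlocks₁₁ ρ.toBlocks₂₁ ρ.toBlocks₁₂ ρ.toBlocks₂₂

/-- A PPT operator on `ℂ² ⊗ ℂⁿ`: it and its partial transpose are positive semidefinite. -/
def IsPPT (ρ : Matrix (n ⊕ n) (n ⊕ n) ℂ) : Prop :=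
  ρ.PosSemidef ∧ (blockTranspose ρ).PosSemidef

/-- The cone of separable operators on `ℂ² ⊗ ℂⁿ`, generated by the projections onto product
vectors `(x, y) ⊗ f`. -/
def sepCone (n : Type*) : AddSubmonoid (Matrix (n ⊕ n) (n ⊕ n) ℂ) :=
  AddSubmonoid.closure
    {M | ∃ (x y : ℂ) (f : n → ℂ), M = vecMulVec (Sum.elim (x • f) (y • f))
      (star (Sum.elim (x • f) (y • f)))}

/-- The local operator `1 ⊗ S` from `ℂ² ⊗ ℂⁿ` to `ℂ² ⊗ ℂᵐ`. -/
def localOp (S : Matrix m n ℂ) : Matrix (m ⊕ m) (n ⊕ n) ℂ := fromBlocks S 0 0 S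

@[simp] theorem blockTranspose_fromBlocks (A B C D : Matrix n n ℂ) :
    blockTranspose (fromBlocks A B C D) = fromBlocks A C B D := rfl

theorem blockTranspose_add (ρ σ : Matrix (n ⊕ n) (n ⊕ n) ℂ) :
    blockTranspose (ρ + σ) = blockTranspose ρ + blockTranspose σ := by
  ext (i | i) (j | j) <;> rfl

theorem blockTranspose_sub (ρ σ : Matrix (n ⊕ n) (n ⊕ n) ℂ) :
    blockTranspose (ρ - σ) = blockTranspose ρ - blockTranspose σ := by
  ext (i | i) (j | j) <;> rfl

theorem blockTranspose_smul (c : ℂ) (ρ : Matrix (n ⊕ n) (n ⊕ n) ℂ) :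
    blockTranspose (c • ρ) = c • blockTranspose ρ := by
  ext (i | i) (j | j) <;> rfl

theorem blockTranspose_conjTranspose (ρ : Matrix (n ⊕ n) (n ⊕ n) ℂ) :
    blockTranspose ρᴴ = (blockTranspose ρ)ᴴ := by
  ext (i | i) (j | j) <;> rfl

theorem localOp_mul_fromBlocks [Fintype n] (S : Matrix m n ℂ) (T : Matrix n k ℂ)
    (A B C D : Matrix n n ℂ) :
    localOp S * fromBlocks A B C D * localOp T =
      fromBlocks (S * A * T) (S * B * T) (S * C * T) (S * D * T) := by
  simp [localOp, fromBlocks_multiply]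

theorem localOp_conjTranspose (S : Matrix m n ℂ) : (localOp S)ᴴ = localOp Sᴴ := by
  simp [localOp, fromBlocks_conjTranspose]

theorem localOp_mul_localOp [Fintype n] (S : Matrix m n ℂ) (T : Matrix n k ℂ) :
    localOp S * localOp T = localOp (S * T) := by
  simp [localOp, fromBlocks_multiply]

theorem localOp_one [DecidableEq n] : localOp (1 : Matrix n n ℂ) = 1 := by
  simp [localOp]

theorem blockTranspose_localOp_mul [Fintype n] (S : Matrix m n ℂ)
    (ρ : Matrix (n ⊕ n) (n ⊕ n) ℂ) :
    blockTranspose (localOp S * ρ * (localOp S)ᴴ) =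
      localOp S * blockTranspose ρ * (localOp S)ᴴ := by
  rw [← fromBlocks_toBlocks ρ]
  simp only [localOp_conjTranspose, localOp_mul_fromBlocks, blockTranspose_fromBlocks]

theorem IsPPT.map_localOp [Fintype m] [Fintype n] {ρ : Matrix (n ⊕ n) (n ⊕ n) ℂ} (h : IsPPT ρ)
    (S : Matrix m n ℂ) : IsPPT (localOp S * ρ * (localOp S)ᴴ) := by
  refine ⟨h.1.mul_mul_conjTranspose_same _, ?_⟩
  rw [blockTranspose_localOp_mul]
  exact h.2.mul_mul_conjTranspose_same _

theorem vecMulVec_mem_sepCone (x y : ℂ) (f : n → ℂ) :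
    vecMulVec (Sum.elim (x • f) (y • f)) (star (Sum.elim (x • f) (y • f))) ∈ sepCone n :=
  AddSubmonoid.subset_closure ⟨x, y, f, rfl⟩

theorem mul_vecMulVec_mul_conjTranspose [Fintype n] (M : Matrix m n ℂ) (f : n → ℂ) :
    M * vecMulVec f (star f) * Mᴴ = vecMulVec (M *ᵥ f) (star (M *ᵥ f)) := by
  rw [mul_vecMulVec, vecMulVec_mul, star_mulVec]

theorem localOp_mulVec [Fintype n] (S : Matrix m n ℂ) (x y : ℂ) (f : n → ℂ) :
    localOp S *ᵥ Sum.elim (x • f) (y • f) = Sum.elim (x • (S *ᵥ f)) (y • (S *ᵥ f)) := by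
  simp [localOp, fromBlocks_mulVec, mulVec_smul]

theorem localOp_mul_mem_sepCone [Fintype n] {ρ : Matrix (n ⊕ n) (n ⊕ n) ℂ}
    (h : ρ ∈ sepCone n) (S : Matrix m n ℂ) :
    localOp S * ρ * (localOp S)ᴴ ∈ sepCone m := by
  induction h using AddSubmonoid.closure_induction with
  | mem M hM =>
    obtain ⟨x, y, f, rfl⟩ := hM
    rw [mul_vecMulVec_mul_conjTranspose, localOp_mulVec]
    exact vecMulVec_mem_sepCone _ _ _
  | zero => simp
  | add a b _ _ ha hb =>
    rw [Matrix.mul_add, Matrix.add_mul]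
    exact add_mem ha hb

/-! ### Factorizations of positive semidefinite matrices -/

/-- Rank factorization: a matrix of rank at most `r` factors through an `r`-dimensional space. -/
theorem exists_eq_mul_of_rank_le [Fintype m] [Fintype n] {r : ℕ} (M : Matrix m n ℂ)
    (h : M.rank ≤ r) : ∃ (F : Matrix m (Fin r) ℂ) (G : Matrix (Fin r) n ℂ), M = F * G := by
  classical
  let b : Module.Basis (Fin M.rank) ℂ (LinearMap.range M.mulVecLin) :=
    Module.finBasisOfFinrankEq _ _ rfl
  let F : Matrix m (Fin M.rank) ℂ := of fun i j => (b j : m → ℂ) i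
  let G : Matrix (Fin M.rank) n ℂ := of fun j i =>
    b.repr ⟨M.mulVecLin (Pi.single i 1), LinearMap.mem_range_self _ _⟩ j
  have hFG : M = F * G := by
    ext i j
    have hb := congrArg (fun v : LinearMap.range M.mulVecLin => (v : m → ℂ) i)
      (b.sum_repr ⟨M.mulVecLin (Pi.single j 1), LinearMap.mem_range_self _ _⟩)
    simp only [Submodule.coe_sum, Submodule.coe_smul, Finset.sum_apply, Pi.smul_apply,
      smul_eq_mul, mulVecLin_apply, mulVec_single_one, col_apply] at hb
    rw [← hb, mul_apply]
    refine Finset.sum_congr rfl fun l _ => ?_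
    simp [F, G, mul_comm]
  let E : Matrix (Fin M.rank) (Fin r) ℂ :=
    (1 : Matrix (Fin r) (Fin r) ℂ).submatrix (Fin.castLE h) id
  have hE : E * Eᵀ = 1 := by
    ext i j
    simp [E, mul_apply, one_apply, Fin.castLE_inj]
  exact ⟨F * E, Eᵀ * G, by
    rw [Matrix.mul_assoc, ← Matrix.mul_assoc E, hE, Matrix.one_mul]; exact hFG⟩

theorem eq_zero_of_rank_eq_zero [Fintype m] [Fintype n] {M : Matrix m n ℂ} (h : M.rank = 0) :
    M = 0 := by
  obtain ⟨F, G, rfl⟩ := exists_eq_mul_of_rank_le M h.le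
  ext i j
  simp [mul_apply]

theorem exists_eq_conjTranspose_mul_self [Fintype n] {M : Matrix n n ℂ} (hM : M.PosSemidef) :
    ∃ S : Matrix n n ℂ, M = Sᴴ * S := by
  classical
  obtain ⟨S, hS⟩ := CStarAlgebra.nonneg_iff_eq_star_mul_self.mp
    (Matrix.nonneg_iff_posSemidef.mpr hM)
  exact ⟨S, hS⟩

/-- A positive semidefinite matrix of rank `r` is `V Vᴴ` for a matrix `V` with `r` columns. -/
theorem exists_eq_mul_conjTranspose_rank [Fintype n] {M : Matrix n n ℂ}
    (hM : M.PosSemidef) : ∃ V : Matrix n (Fin M.rank) ℂ, M = V * Vᴴ := by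
  obtain ⟨S, hS⟩ := exists_eq_conjTranspose_mul_self hM
  obtain ⟨F, G, hFG⟩ := exists_eq_mul_of_rank_le S (r := M.rank)
    (by conv_rhs => rw [hS, rank_conjTranspose_mul_self])
  obtain ⟨T, hT⟩ := exists_eq_conjTranspose_mul_self (posSemidef_conjTranspose_mul_self F)
  refine ⟨Gᴴ * Tᴴ, ?_⟩
  rw [conjTranspose_mul, conjTranspose_conjTranspose, conjTranspose_conjTranspose,
    ← Matrix.mul_assoc, Matrix.mul_assoc Gᴴ, ← hT]
  conv_lhs => rw [hS, hFG]
  simp only [conjTranspose_mul, Matrix.mul_assoc]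

/-! ### Splitting PPT operators of large rank -/

/-- A Hermitian matrix that is not scalar can be shifted by its extreme eigenvalues `a < b`. -/
theorem exists_extreme_eigenvalues [Fintype n] [DecidableEq n] {K : Matrix n n ℂ}
    (hK : K.IsHermitian) (hs : ∀ c : ℂ, K ≠ c • 1) :
    ∃ a b : ℝ, a < b ∧ (K - (a : ℂ) • 1).PosSemidef ∧ ((b : ℂ) • 1 - K).PosSemidef ∧
      (K - (a : ℂ) • 1).det = 0 ∧ ((b : ℂ) • 1 - K).det = 0 := by
  have hne : Nonempty n := by
    by_contra h
    rw [not_nonempty_iff] at h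
    exact hs 0 (Subsingleton.elim _ _)
  obtain ⟨i, hi⟩ := Finite.exists_min hK.eigenvalues
  obtain ⟨j, hj⟩ := Finite.exists_max hK.eigenvalues
  let U : Matrix n n ℂ := hK.eigenvectorUnitary
  have hUU : U * Uᴴ = 1 := Unitary.mul_star_self_of_mem hK.eigenvectorUnitary.2
  have hKU : K = U * diagonal (fun l => (hK.eigenvalues l : ℂ)) * Uᴴ := by
    conv_lhs => rw [hK.spectral_theorem]
    rfl
  have hscal (c : ℂ) : c • (1 : Matrix n n ℂ) = U * diagonal (fun _ => c) * Uᴴ := by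
    rw [← smul_one_eq_diagonal, Matrix.mul_smul, Matrix.smul_mul, Matrix.mul_one, hUU]
  have hsub (c : ℂ) : K - c • 1 = U * diagonal (fun l => (hK.eigenvalues l : ℂ) - c) * Uᴴ := by
    rw [hscal]
    conv_lhs => rw [hKU]
    rw [← Matrix.sub_mul, ← Matrix.mul_sub, diagonal_sub]
  have hdet (l : n) : (K - (hK.eigenvalues l : ℂ) • 1).det = 0 := by
    rw [hsub, det_mul, det_mul, det_diagonal, Finset.prod_eq_zero (Finset.mem_univ l) (sub_self _)]
    simp
  refine ⟨hK.eigenvalues i, hK.eigenvalues j, lt_of_le_of_ne (hi j) fun h => ?_, ?_, ?_, hdet i, ?_⟩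
  · apply hs (hK.eigenvalues i)
    rw [hscal]
    conv_lhs => rw [hKU]
    congr 3
    funext l
    rw [le_antisymm ((hj l).trans h.ge) (hi l)]
  · rw [hsub]
    refine (PosSemidef.diagonal fun l => ?_).mul_mul_conjTranspose_same U
    simpa using hi l
  · rw [← neg_sub, hsub, ← Matrix.neg_mul, ← Matrix.mul_neg, diagonal_neg]
    refine (PosSemidef.diagonal fun l => ?_).mul_mul_conjTranspose_same U
    simpa using hj l
  · rw [← neg_sub, det_neg, hdet, mul_zero]

theorem rank_lt_card_of_det_eq_zero [Fintype n] [DecidableEq n] {M : Matrix n n ℂ}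
    (h : M.det = 0) : M.rank < Fintype.card n := by
  obtain ⟨v, hv, hMv⟩ := exists_mulVec_eq_zero_iff.mpr h
  have h1 : M * replicateCol Unit v = 0 := by
    rw [← replicateCol_mulVec, hMv]; rfl
  have h2 := rank_add_rank_le_card_of_mul_eq_zero h1
  have h3 : (replicateCol Unit v).rank ≠ 0 := by
    intro h
    exact hv (funext fun i => congrFun (congrFun (eq_zero_of_rank_eq_zero h) i) ())
  omega

/-- If `M ⊕ M'` is singular, the total rank of `V M Vᴴ` and `W M' Wᴴ` is less than the total number
of columns of `V` and `W`. -/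
theorem rank_add_rank_lt {r s : ℕ} [Fintype m] (V : Matrix m (Fin r) ℂ) (W : Matrix m (Fin s) ℂ)
    (M : Matrix (Fin r) (Fin r) ℂ) (M' : Matrix (Fin s) (Fin s) ℂ)
    (h : (fromBlocks M 0 0 M').det = 0) :
    (V * M * Vᴴ).rank + (W * M' * Wᴴ).rank < r + s := by
  have hV : (V * M * Vᴴ).rank ≤ M.rank :=
    (rank_mul_le_left _ _).trans (rank_mul_le_right _ _)
  have hW : (W * M' * Wᴴ).rank ≤ M'.rank :=
    (rank_mul_le_left _ _).trans (rank_mul_le_right _ _)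
  have h1 := M.rank_le_width
  have h2 := M'.rank_le_width
  rw [det_fromBlocks_zero₂₁, mul_eq_zero] at h
  rcases h with h | h
  all_goals
    have := rank_lt_card_of_det_eq_zero h
    rw [Fintype.card_fin] at this
    omega

/-- Perturbations of a PPT operator `V Vᴴ` with partial transpose `W Wᴴ`: the pairs `(M, M')` for
which `V M Vᴴ` has partial transpose `W M' Wᴴ` form a complex space closed under `ᴴ`, of dimension
at least `r² + s² - (2 dim)²`. When this exceeds one, not all its Hermitian elements are multiples
of `(1, 1)`. -/
theorem exists_hermitian_pair {r s : ℕ} [Fintype n]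
    (V : Matrix (n ⊕ n) (Fin r) ℂ) (W : Matrix (n ⊕ n) (Fin s) ℂ)
    (h : 4 * Fintype.card n ^ 2 + 1 < r ^ 2 + s ^ 2) :
    ∃ (M : Matrix (Fin r) (Fin r) ℂ) (M' : Matrix (Fin s) (Fin s) ℂ),
      blockTranspose (V * M * Vᴴ) = W * M' * Wᴴ ∧ (fromBlocks M 0 0 M').IsHermitian ∧
      ∀ c : ℂ, fromBlocks M 0 0 M' ≠ c • 1 := by
  let L : (Matrix (Fin r) (Fin r) ℂ × Matrix (Fin s) (Fin s) ℂ) →ₗ[ℂ]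
      Matrix (n ⊕ n) (n ⊕ n) ℂ :=
    { toFun := fun p => blockTranspose (V * p.1 * Vᴴ) - W * p.2 * Wᴴ
      map_add' := fun p q => by
        simp only [Prod.fst_add, Prod.snd_add, Matrix.mul_add, Matrix.add_mul, blockTranspose_add]
        abel
      map_smul' := fun c p => by
        simp only [Prod.smul_fst, Prod.smul_snd, Matrix.mul_smul, Matrix.smul_mul,
          blockTranspose_smul, RingHom.id_apply, smul_sub] }
  have hmem (p) : p ∈ LinearMap.ker L ↔ blockTranspose (V * p.1 * Vᴴ) = W * p.2 * Wᴴ := by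
    rw [LinearMap.mem_ker]
    exact sub_eq_zero
  have hstar (p : Matrix (Fin r) (Fin r) ℂ × Matrix (Fin s) (Fin s) ℂ)
      (hp : p ∈ LinearMap.ker L) : (p.1ᴴ, p.2ᴴ) ∈ LinearMap.ker L := by
    rw [hmem] at hp ⊢
    have := congrArg conjTranspose hp
    rw [← blockTranspose_conjTranspose] at this
    simpa [conjTranspose_mul, Matrix.mul_assoc] using this
  by_contra! hcon
  have hscal (p) (hp : p ∈ LinearMap.ker L) (hH : p.1.IsHermitian ∧ p.2.IsHermitian) :
      ∃ c : ℂ, p = c • (1, 1) := by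
    obtain ⟨c, hc⟩ := hcon p.1 p.2 ((hmem p).mp hp)
      (by rw [isHermitian_fromBlocks_iff]; exact ⟨hH.1, by simp, by simp, hH.2⟩)
    rw [← fromBlocks_one, fromBlocks_smul, fromBlocks_inj] at hc
    exact ⟨c, Prod.ext hc.1 hc.2.2.2⟩
  have hle : LinearMap.ker L ≤ Submodule.span ℂ {((1, 1) :
      Matrix (Fin r) (Fin r) ℂ × Matrix (Fin s) (Fin s) ℂ)} := by
    intro p hp
    obtain ⟨a, ha⟩ := hscal (p + (p.1ᴴ, p.2ᴴ)) (add_mem hp (hstar p hp))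
      ⟨by simp [IsHermitian, add_comm], by simp [IsHermitian, add_comm]⟩
    obtain ⟨b, hb⟩ := hscal (Complex.I • (p - (p.1ᴴ, p.2ᴴ)))
      (Submodule.smul_mem _ _ (sub_mem hp (hstar p hp)))
      ⟨by simp [IsHermitian, conjTranspose_smul, ← smul_neg],
        by simp [IsHermitian, conjTranspose_smul, ← smul_neg]⟩
    -- `p` is recovered from its real part, a multiple `a / 2` of `(1, 1)`, and its imaginary part
    rw [Submodule.mem_span_singleton]
    refine ⟨(a - Complex.I * b) / 2, ?_⟩
    have hb' : p - (p.1ᴴ, p.2ᴴ) = (-Complex.I * b) • (1, 1) := by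
      rw [mul_smul, ← hb, smul_smul]
      simp
    have h2 : (2 : ℂ) • p = (a - Complex.I * b) • (1, 1) := by
      rw [sub_eq_add_neg, add_smul, ← ha, ← neg_mul, ← hb', two_smul]
      abel
    rw [div_eq_inv_mul, mul_smul, ← h2, smul_smul]
    simp
  have h1 := (Submodule.finrank_mono hle).trans (finrank_span_le_card _)
  have h2 := L.finrank_range_add_finrank_ker
  have h3 := Submodule.finrank_le (LinearMap.range L)
  simp only [Module.finrank_prod, Module.finrank_matrix, Fintype.card_fin, Module.finrank_self,
    Fintype.card_sum] at h2 h3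
  simp at h1
  nlinarith

/-- PPT operators of large rank are not extreme: if `r² + s² > (2 dim)² + 1` for the ranks `r` and
`s` of `ρ` and of its partial transpose, then `ρ` is a sum of two PPT operators of smaller total
rank. -/
theorem IsPPT.exists_add_of_rank_large [Fintype n] {ρ : Matrix (n ⊕ n) (n ⊕ n) ℂ} (hρ : IsPPT ρ)
    (h : 4 * Fintype.card n ^ 2 + 1 < ρ.rank ^ 2 + (blockTranspose ρ).rank ^ 2) :
    ∃ σ τ, IsPPT σ ∧ IsPPT τ ∧ ρ = σ + τ ∧
      σ.rank + (blockTranspose σ).rank < ρ.rank + (blockTranspose ρ).rank ∧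
      τ.rank + (blockTranspose τ).rank < ρ.rank + (blockTranspose ρ).rank := by
  obtain ⟨V, hV⟩ := exists_eq_mul_conjTranspose_rank hρ.1
  obtain ⟨W, hW⟩ := exists_eq_mul_conjTranspose_rank hρ.2
  obtain ⟨M, M', hM, hH, hs⟩ := exists_hermitian_pair V W h
  obtain ⟨a, b, hab, ha, hb, ha', hb'⟩ := exists_extreme_eigenvalues hH hs
  have hK (c : ℂ) : fromBlocks M 0 0 M' - c • 1 = fromBlocks (M - c • 1) 0 0 (M' - c • 1) := by
    rw [← fromBlocks_one, fromBlocks_smul, sub_eq_add_neg, fromBlocks_neg, fromBlocks_add]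
    simp [sub_eq_add_neg]
  have hK' (c : ℂ) : c • 1 - fromBlocks M 0 0 M' = fromBlocks (c • 1 - M) 0 0 (c • 1 - M') := by
    rw [← neg_sub, hK, fromBlocks_neg]
    simp
  rw [hK] at ha ha'
  rw [hK'] at hb hb'
  -- a singular positive semidefinite perturbation gives a PPT operator of smaller total rank
  have key (t : ℝ) (ht : 0 < t) (X : Matrix (Fin ρ.rank) (Fin ρ.rank) ℂ)
      (X' : Matrix (Fin (blockTranspose ρ).rank)
        (Fin (blockTranspose ρ).rank) ℂ)
      (hX : blockTranspose (V * X * Vᴴ) = W * X' * Wᴴ)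
      (hp : (fromBlocks X 0 0 X').PosSemidef) (hd : (fromBlocks X 0 0 X').det = 0) :
      IsPPT ((t : ℂ) • (V * X * Vᴴ)) ∧ ((t : ℂ) • (V * X * Vᴴ)).rank +
        (blockTranspose ((t : ℂ) • (V * X * Vᴴ))).rank <
          ρ.rank + (blockTranspose ρ).rank := by
    have ht' : (0 : ℂ) ≤ t := by exact_mod_cast ht.le
    have ht0 : (t : ℂ) ≠ 0 := by exact_mod_cast ht.ne'
    have hr := rank_add_rank_lt V W X X' hd
    rw [← hX] at hr
    refine ⟨⟨((hp.submatrix Sum.inl).mul_mul_conjTranspose_same V).smul ht', ?_⟩, ?_⟩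
    · rw [blockTranspose_smul, hX]
      exact ((hp.submatrix Sum.inr).mul_mul_conjTranspose_same W).smul ht'
    · rw [blockTranspose_smul,
        rank_smul_of_mem_nonZeroDivisors _ (mem_nonZeroDivisors_of_ne_zero ht0),
        rank_smul_of_mem_nonZeroDivisors _ (mem_nonZeroDivisors_of_ne_zero ht0)]
      exact hr
  have hone : blockTranspose (V * Vᴴ) = W * Wᴴ := by rw [← hV, ← hW]
  have hba : 0 < (b - a)⁻¹ := inv_pos.mpr (sub_pos.mpr hab)
  -- the two boundary points in the directions `M` and `-M`; they add up to `ρ`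
  obtain ⟨h1, h1'⟩ := key _ hba _ _ (by
    simp only [Matrix.mul_sub, Matrix.sub_mul, Matrix.mul_smul, Matrix.smul_mul, Matrix.mul_one,
      blockTranspose_sub, blockTranspose_smul, hM, hone]) ha ha'
  obtain ⟨h2, h2'⟩ := key _ hba _ _ (by
    simp only [Matrix.mul_sub, Matrix.sub_mul, Matrix.mul_smul, Matrix.smul_mul, Matrix.mul_one,
      blockTranspose_sub, blockTranspose_smul, hM, hone]) hb hb'
  refine ⟨_, _, h1, h2, ?_, h1', h2'⟩
  have hne : (b : ℂ) - a ≠ 0 := by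
    rw [sub_ne_zero]; exact_mod_cast hab.ne'
  conv_lhs => rw [hV]
  rw [← smul_add, ← Matrix.add_mul, ← Matrix.mul_add]
  simp only [sub_add_sub_cancel', ← sub_smul]
  rw [Matrix.mul_smul, Matrix.smul_mul, Matrix.mul_one, smul_smul]
  push_cast
  rw [inv_mul_cancel₀ hne, one_smul]

/-! ### Product vectors in the kernel -/

/-- Subtracting from a positive semidefinite matrix its part in the direction `ξ` leaves a positive
semidefinite matrix. If `ξ* M ξ = 0` nothing is subtracted, since `0⁻¹ = 0`. -/
theorem _root_.Matrix.PosSemidef.sub_smul_vecMulVec_mulVec [Fintype n] {M : Matrix n n ℂ}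
    (hM : M.PosSemidef) (ξ : n → ℂ) :
    (M - (star ξ ⬝ᵥ M *ᵥ ξ)⁻¹ • vecMulVec (M *ᵥ ξ) (star (M *ᵥ ξ))).PosSemidef := by
  classical
  set c := star ξ ⬝ᵥ M *ᵥ ξ with hc
  by_cases h0 : c = 0
  · simpa [h0] using hM
  -- for `c ≠ 0` the difference is `Qᴴ M Q`, where `Q` is the oblique projection killing `ξ`
  have hξ : star (M *ᵥ ξ) = star ξ ᵥ* M := by
    rw [star_mulVec, hM.isHermitian.eq]
  let Q : Matrix n n ℂ := 1 - c⁻¹ • vecMulVec ξ (star (M *ᵥ ξ))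
  have hMQ : M * Q = M - c⁻¹ • vecMulVec (M *ᵥ ξ) (star (M *ᵥ ξ)) := by
    rw [Matrix.mul_sub, Matrix.mul_one, Matrix.mul_smul, mul_vecMulVec]
  have hξMQ : star ξ ᵥ* (M * Q) = 0 := by
    rw [hMQ, vecMul_sub, vecMul_smul, vecMul_vecMulVec, ← hξ, ← hc, smul_smul,
      inv_mul_cancel₀ h0, one_smul, sub_self]
  have key : Qᴴ * M * Q = M * Q := by
    rw [Matrix.mul_assoc]
    simp only [Q, conjTranspose_sub, conjTranspose_one, conjTranspose_smul,
      conjTranspose_vecMulVec, star_star, Matrix.sub_mul, Matrix.one_mul, Matrix.smul_mul]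
    rw [vecMulVec_mul]
    change _ - _ • vecMulVec _ (star ξ ᵥ* (M * Q)) = _
    rw [hξMQ]
    simp
  rw [← hMQ, ← key]
  exact hM.conjTranspose_mul_mul_same Q

theorem IsPPT.exists_fromBlocks {ρ : Matrix (n ⊕ n) (n ⊕ n) ℂ} (h : IsPPT ρ) :
    ∃ A B C, ρ = fromBlocks A B Bᴴ C ∧ A.PosSemidef ∧ C.PosSemidef := by
  refine ⟨ρ.toBlocks₁₁, ρ.toBlocks₁₂, ρ.toBlocks₂₂, ?_, h.1.submatrix Sum.inl,
    h.1.submatrix Sum.inr⟩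
  have h1 := h.1.isHermitian
  rw [← fromBlocks_toBlocks ρ, isHermitian_fromBlocks_iff] at h1
  rw [h1.2.1]
  exact (fromBlocks_toBlocks ρ).symm

/-- For a positive semidefinite block matrix, a kernel vector of the first diagonal block is in the
kernel of the whole first block column. -/
theorem conjTranspose_mulVec_eq_zero [Fintype n] {A B C : Matrix n n ℂ}
    (h : (fromBlocks A B Bᴴ C).PosSemidef) {y : n → ℂ} (hy : A *ᵥ y = 0) : Bᴴ *ᵥ y = 0 := by
  have h1 := (h.dotProduct_mulVec_zero_iff (Sum.elim y 0)).mp (by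
    rw [fromBlocks_mulVec, Sum.elim_comp_inl, Sum.elim_comp_inr, hy, mulVec_zero, mulVec_zero]
    simp [dotProduct])
  rw [fromBlocks_mulVec, Sum.elim_comp_inl, Sum.elim_comp_inr, mulVec_zero, mulVec_zero] at h1
  funext i
  simpa using congrFun h1 (Sum.inr i)

theorem fromBlocks_sub_posSemidef [Fintype n] {A B C : Matrix n n ℂ}
    (h : (fromBlocks A B Bᴴ C).PosSemidef) {y : n → ℂ} (hy : B *ᵥ y = 0) :
    (fromBlocks A B Bᴴ
      (C - (star y ⬝ᵥ C *ᵥ y)⁻¹ • vecMulVec (C *ᵥ y) (star (C *ᵥ y)))).PosSemidef := by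
  have h1 := h.sub_smul_vecMulVec_mulVec (Sum.elim (0 : n → ℂ) y)
  have h2 : fromBlocks A B Bᴴ C *ᵥ Sum.elim (0 : n → ℂ) y = Sum.elim (0 : n → ℂ) (C *ᵥ y) := by
    simp [fromBlocks_mulVec, hy]
  have h3 : star (Sum.elim (0 : n → ℂ) y) ⬝ᵥ Sum.elim (0 : n → ℂ) (C *ᵥ y) = star y ⬝ᵥ C *ᵥ y := by
    simp [dotProduct]
  rw [h2, h3] at h1
  convert h1 using 1
  ext (i | i) (j | j) <;> simp [vecMulVec_apply]

theorem exists_ofReal_of_nonneg {c : ℂ} (hc : 0 ≤ c) : ∃ r : ℝ, 0 ≤ r ∧ c = r :=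
  ⟨c.re, (Complex.nonneg_iff.mp hc).1, Complex.ext rfl (Complex.nonneg_iff.mp hc).2.symm⟩

/-- The projection onto `(1, z̄) ⊗ f`, with a nonnegative weight. -/
theorem fromBlocks_vecMulVec_mem_sepCone {c : ℂ} (hc : 0 ≤ c) (z : ℂ) (f : n → ℂ) :
    fromBlocks (c • vecMulVec f (star f)) ((c * z) • vecMulVec f (star f))
      ((c * star z) • vecMulVec f (star f)) ((c * (z * star z)) • vecMulVec f (star f)) ∈
      sepCone n := by
  obtain ⟨r, hr, rfl⟩ := exists_ofReal_of_nonneg hc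
  have hs : (Real.sqrt r : ℂ) * Real.sqrt r = r := by
    rw [← Complex.ofReal_mul, Real.mul_self_sqrt hr]
  convert vecMulVec_mem_sepCone (Real.sqrt r : ℂ) (Real.sqrt r * star z) f using 1
  ext (i | i) (j | j) <;> simp [vecMulVec_apply, ← hs] <;> ring

theorem fromBlocks_zero_vecMulVec_mem_sepCone {c : ℂ} (hc : 0 ≤ c) (f : n → ℂ) :
    fromBlocks 0 0 0 (c • vecMulVec f (star f)) ∈ sepCone n := by
  obtain ⟨r, hr, rfl⟩ := exists_ofReal_of_nonneg hc
  have hs : (Real.sqrt r : ℂ) * Real.sqrt r = r := by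
    rw [← Complex.ofReal_mul, Real.mul_self_sqrt hr]
  convert vecMulVec_mem_sepCone 0 (Real.sqrt r : ℂ) f using 1
  ext (i | i) (j | j) <;> simp [vecMulVec_apply, ← hs]
  ring

/-- The orthogonal projection onto `y^⊥` factors through a space of smaller dimension. -/
theorem exists_mul_conjTranspose_eq_one_sub [Fintype n] [DecidableEq n] {y : n → ℂ} (hy : y ≠ 0) :
    ∃ (r : ℕ) (S : Matrix n (Fin r) ℂ), r < Fintype.card n ∧
      S * Sᴴ = 1 - (star y ⬝ᵥ y)⁻¹ • vecMulVec y (star y) ∧ (S * Sᴴ).rank = r ∧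
      (S * Sᴴ) *ᵥ y = 0 := by
  have h1 := (PosSemidef.one (n := n) (R := ℂ)).sub_smul_vecMulVec_mulVec y
  rw [one_mulVec] at h1
  obtain ⟨S, hS⟩ := exists_eq_mul_conjTranspose_rank h1
  have h0 : star y ⬝ᵥ y ≠ 0 := by rwa [Ne, dotProduct_star_self_eq_zero]
  have hPy : (1 - (star y ⬝ᵥ y)⁻¹ • vecMulVec y (star y)) *ᵥ y = 0 := by
    rw [sub_mulVec, one_mulVec, smul_mulVec, vecMulVec_mulVec]
    simp [smul_smul, inv_mul_cancel₀ h0]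
  refine ⟨_, S, ?_, hS.symm, by rw [← hS], by rw [← hS, hPy]⟩
  exact rank_lt_card_of_det_eq_zero (exists_mulVec_eq_zero_iff.mp ⟨y, hy, hPy⟩)

theorem one_sub_mul_mul_one_sub [Fintype n] [DecidableEq n] {X : Matrix n n ℂ} {y : n → ℂ} (c : ℂ)
    (h : X *ᵥ y = 0) (h' : Xᴴ *ᵥ y = 0) :
    (1 - c • vecMulVec y (star y)) * X * (1 - c • vecMulVec y (star y)) = X := by
  have h1 : vecMulVec y (star y) * X = 0 := by
    rw [vecMulVec_mul, ← star_star (star y ᵥ* X), star_vecMul, star_star, h']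
    simp
  have h2 : X * vecMulVec y (star y) = 0 := by
    rw [mul_vecMulVec, h]
    simp
  rw [Matrix.sub_mul, Matrix.smul_mul, h1, smul_zero, sub_zero, Matrix.one_mul, Matrix.mul_sub,
    Matrix.mul_smul, h2, smul_zero, sub_zero, Matrix.mul_one]

/-- If `e₁ ⊗ y` is in the kernel of a PPT operator `ρ`, then `e₂ ⊗ C y` is in the ranges of `ρ` and
of its partial transpose; splitting it off leaves an operator supported on `ℂ² ⊗ y^⊥`. -/
theorem IsPPT.mem_sepCone_of_mulVec_eq_zero [Fintype n] {A B C : Matrix n n ℂ}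
    (hρ : IsPPT (fromBlocks A B Bᴴ C)) {y : n → ℂ} (hy : y ≠ 0) (hAy : A *ᵥ y = 0)
    (ih : ∀ r < Fintype.card n, ∀ σ : Matrix (Fin r ⊕ Fin r) (Fin r ⊕ Fin r) ℂ,
      IsPPT σ → σ ∈ sepCone (Fin r)) :
    fromBlocks A B Bᴴ C ∈ sepCone n := by
  classical
  have hA : A.PosSemidef := hρ.1.submatrix Sum.inl
  have hC : C.PosSemidef := hρ.1.submatrix Sum.inr
  have hΓ : (fromBlocks A Bᴴ Bᴴᴴ C).PosSemidef := by
    rw [conjTranspose_conjTranspose]; exact hρ.2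
  have hB' := conjTranspose_mulVec_eq_zero hρ.1 hAy
  have hB := conjTranspose_mulVec_eq_zero hΓ hAy
  rw [conjTranspose_conjTranspose] at hB
  set c := star y ⬝ᵥ C *ᵥ y with hc
  set C' := C - c⁻¹ • vecMulVec (C *ᵥ y) (star (C *ᵥ y)) with hC'
  have hc0 : 0 ≤ c := hC.dotProduct_mulVec_nonneg y
  have hσ : IsPPT (fromBlocks A B Bᴴ C') := by
    refine ⟨fromBlocks_sub_posSemidef hρ.1 hB, ?_⟩
    have := fromBlocks_sub_posSemidef hΓ hB'
    rwa [conjTranspose_conjTranspose] at this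
  have hC'y : C' *ᵥ y = 0 := by
    have hstar : star (C *ᵥ y) ⬝ᵥ y = c := by
      rw [star_mulVec, hC.isHermitian.eq, ← dotProduct_mulVec]
    rw [hC', sub_mulVec, smul_mulVec, vecMulVec_mulVec, hstar]
    by_cases h0 : c = 0
    · rw [(hC.dotProduct_mulVec_zero_iff y).mp h0]
      simp
    · simp [smul_smul, inv_mul_cancel₀ h0]
  have hC'h : C'ᴴ *ᵥ y = 0 := by
    rw [(hσ.1.submatrix Sum.inr).isHermitian.eq (A := C')]; exact hC'y
  obtain ⟨r, S, hr, hS, -, -⟩ := exists_mul_conjTranspose_eq_one_sub hy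
  have h1 := localOp_mul_mem_sepCone (ih r hr _ (hσ.map_localOp Sᴴ)) S
  have h2 : localOp S * (localOp Sᴴ * fromBlocks A B Bᴴ C' * (localOp Sᴴ)ᴴ) * (localOp S)ᴴ =
      fromBlocks A B Bᴴ C' := by
    rw [localOp_conjTranspose, localOp_conjTranspose, conjTranspose_conjTranspose,
      localOp_mul_fromBlocks, localOp_mul_fromBlocks]
    have key (X : Matrix n n ℂ) (h : X *ᵥ y = 0) (h' : Xᴴ *ᵥ y = 0) :
        S * (Sᴴ * X * S) * Sᴴ = X := by
      rw [show S * (Sᴴ * X * S) * Sᴴ = (S * Sᴴ) * X * (S * Sᴴ) by simp only [Matrix.mul_assoc], hS]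
      exact one_sub_mul_mul_one_sub _ h h'
    rw [key A hAy (by rw [hA.isHermitian.eq]; exact hAy), key B hB hB',
      key Bᴴ hB' (by rw [conjTranspose_conjTranspose]; exact hB), key C' hC'y hC'h]
  rw [h2] at h1
  have h3 := add_mem h1 (fromBlocks_zero_vecMulVec_mem_sepCone (inv_nonneg.mpr hc0) (C *ᵥ y))
  rw [fromBlocks_add] at h3
  simpa [hC'] using h3

/-! ### Normal matrices -/

/-- A normal matrix `N` defines a separable operator: in an orthonormal eigenbasis `f` with
eigenvalues `z` it is the sum of the projections onto `(1, z̄) ⊗ f`. -/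
theorem fromBlocks_mem_sepCone_of_normal (r : ℕ) :
    ∀ (n : Type) [Fintype n] [DecidableEq n] (N : Matrix n n ℂ), Fintype.card n = r →
      Nᴴ * N = N * Nᴴ → fromBlocks 1 N Nᴴ (Nᴴ * N) ∈ sepCone n := by
  induction r using Nat.strong_induction_on with
  | _ r ih =>
  intro n _ _ N hr hN
  rcases isEmpty_or_nonempty n with hn | hn
  · convert zero_mem (sepCone n) using 1
    exact Subsingleton.elim _ _
  obtain ⟨z, hz⟩ := Module.End.exists_eigenvalue (Matrix.toLin' N)
  obtain ⟨f, hf⟩ := hz.exists_hasEigenvector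
  have hf0 : f ≠ 0 := hf.2
  have hNf : N *ᵥ f = z • f := by simpa using hf.apply_eq_smul
  have hNf' : Nᴴ *ᵥ f = star z • f := by
    have h1 : (N - z • 1) *ᵥ f = 0 := by rw [sub_mulVec, smul_mulVec, one_mulVec, hNf, sub_self]
    have h2 : (N - z • 1)ᴴ * (N - z • 1) = (N - z • 1) * (N - z • 1)ᴴ := by
      simp only [conjTranspose_sub, conjTranspose_smul, conjTranspose_one, Matrix.sub_mul,
        Matrix.mul_sub, hN, Matrix.smul_mul, Matrix.mul_smul, Matrix.one_mul, Matrix.mul_one,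
        smul_sub, smul_comm z (star z)]
      abel
    have h3 : (N - z • 1)ᴴ *ᵥ f = 0 := by
      rw [← dotProduct_star_self_eq_zero, star_mulVec, conjTranspose_conjTranspose,
        ← dotProduct_mulVec, mulVec_mulVec, ← h2, ← mulVec_mulVec, h1, mulVec_zero,
        dotProduct_zero]
    rwa [conjTranspose_sub, conjTranspose_smul, conjTranspose_one, sub_mulVec, smul_mulVec,
      one_mulVec, sub_eq_zero] at h3
  -- split off `f`; the compression `Sᴴ N S` to `f^⊥` is normal because `f^⊥` reduces `N`
  obtain ⟨r', S, hr', hS, hrank, hSf⟩ := exists_mul_conjTranspose_eq_one_sub hf0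
  set t := star f ⬝ᵥ f with ht
  have ht0 : t ≠ 0 := by rwa [ht, Ne, dotProduct_star_self_eq_zero]
  have htn : 0 ≤ t := dotProduct_star_self_nonneg f
  have hPP : S * Sᴴ * (S * Sᴴ) = S * Sᴴ := by
    nth_rw 2 [hS]
    rw [Matrix.mul_sub, Matrix.mul_one, Matrix.mul_smul, mul_vecMulVec, hSf]
    simp
  have hSS : Sᴴ * S = 1 := by
    have hu : IsUnit (Sᴴ * S).det := by
      rw [isUnit_iff_ne_zero]
      intro h0
      have := rank_lt_card_of_det_eq_zero h0
      rw [rank_conjTranspose_mul_self, ← rank_self_mul_conjTranspose, hrank,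
        Fintype.card_fin] at this
      exact lt_irrefl _ this
    have hu' : IsUnit (Sᴴ * S) := (isUnit_iff_isUnit_det _).mpr hu
    have h1 : (Sᴴ * S) * (Sᴴ * S) * (Sᴴ * S) = (Sᴴ * S) * (Sᴴ * S) * 1 := by
      rw [show (Sᴴ * S) * (Sᴴ * S) * (Sᴴ * S) = Sᴴ * ((S * Sᴴ) * (S * Sᴴ)) * S by
        simp only [Matrix.mul_assoc], hPP]
      simp only [Matrix.mul_assoc, Matrix.mul_one]
    exact (hu'.mul hu').mul_left_cancel h1
  have hvN : star f ᵥ* N = z • star f := by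
    rw [← star_star (star f ᵥ* N), star_vecMul, star_star, hNf', star_smul, star_star]
  have hvN' : star f ᵥ* Nᴴ = star z • star f := by
    rw [← star_star (star f ᵥ* Nᴴ), star_vecMul, star_star, conjTranspose_conjTranspose, hNf,
      star_smul]
  have hNP : N * (S * Sᴴ) = N - (t⁻¹ * z) • vecMulVec f (star f) := by
    rw [hS, Matrix.mul_sub, Matrix.mul_one, Matrix.mul_smul, mul_vecMulVec, hNf, smul_vecMulVec,
      smul_smul]
  have hPN : S * Sᴴ * N = N - (t⁻¹ * z) • vecMulVec f (star f) := by
    rw [hS, Matrix.sub_mul, Matrix.one_mul, Matrix.smul_mul, vecMulVec_mul, hvN, vecMulVec_smul,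
      smul_smul]
  have hNP' : Nᴴ * (S * Sᴴ) = Nᴴ - (t⁻¹ * star z) • vecMulVec f (star f) := by
    rw [hS, Matrix.mul_sub, Matrix.mul_one, Matrix.mul_smul, mul_vecMulVec, hNf', smul_vecMulVec,
      smul_smul]
  have hPN' : S * Sᴴ * Nᴴ = Nᴴ - (t⁻¹ * star z) • vecMulVec f (star f) := by
    rw [hS, Matrix.sub_mul, Matrix.one_mul, Matrix.smul_mul, vecMulVec_mul, hvN', vecMulVec_smul,
      smul_smul]
  have hN1 : (Sᴴ * N * S)ᴴ * (Sᴴ * N * S) = Sᴴ * (Nᴴ * N) * S := by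
    calc (Sᴴ * N * S)ᴴ * (Sᴴ * N * S) = Sᴴ * Nᴴ * (S * Sᴴ * N) * S := by
          simp only [conjTranspose_mul, conjTranspose_conjTranspose, Matrix.mul_assoc]
      _ = Sᴴ * Nᴴ * N * S * (Sᴴ * S) := by
          rw [hPN, ← hNP]; simp only [Matrix.mul_assoc]
      _ = Sᴴ * (Nᴴ * N) * S := by rw [hSS, Matrix.mul_one]; simp only [Matrix.mul_assoc]
  have hN2 : (Sᴴ * N * S) * (Sᴴ * N * S)ᴴ = Sᴴ * (N * Nᴴ) * S := by
    calc (Sᴴ * N * S) * (Sᴴ * N * S)ᴴ = Sᴴ * N * (S * Sᴴ * Nᴴ) * S := by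
          simp only [conjTranspose_mul, conjTranspose_conjTranspose, Matrix.mul_assoc]
      _ = Sᴴ * N * Nᴴ * S * (Sᴴ * S) := by
          rw [hPN', ← hNP']; simp only [Matrix.mul_assoc]
      _ = Sᴴ * (N * Nᴴ) * S := by rw [hSS, Matrix.mul_one]; simp only [Matrix.mul_assoc]
  have h1 := ih r' (hr ▸ hr') (Fin r') (Sᴴ * N * S) (Fintype.card_fin r') (by rw [hN1, hN2, hN])
  have h2 := localOp_mul_mem_sepCone h1 S
  have h3 := add_mem h2 (fromBlocks_vecMulVec_mem_sepCone (inv_nonneg.mpr htn) z f)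
  have e2 : S * (Sᴴ * N * S) * Sᴴ = N - (t⁻¹ * z) • vecMulVec f (star f) := by
    rw [← hNP, show S * (Sᴴ * N * S) * Sᴴ = (S * Sᴴ * N) * (S * Sᴴ) by
      simp only [Matrix.mul_assoc], hPN, ← hNP, Matrix.mul_assoc, hPP]
  have e3 : S * (Sᴴ * N * S)ᴴ * Sᴴ = Nᴴ - (t⁻¹ * star z) • vecMulVec f (star f) := by
    rw [← hNP', conjTranspose_mul, conjTranspose_mul, conjTranspose_conjTranspose,
      show S * (Sᴴ * (Nᴴ * S)) * Sᴴ = (S * Sᴴ * Nᴴ) * (S * Sᴴ) by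
      simp only [Matrix.mul_assoc], hPN', ← hNP', Matrix.mul_assoc, hPP]
  have e4 : S * (Sᴴ * (Nᴴ * N) * S) * Sᴴ =
      Nᴴ * N - (t⁻¹ * (z * star z)) • vecMulVec f (star f) := by
    rw [show S * (Sᴴ * (Nᴴ * N) * S) * Sᴴ = (S * Sᴴ * Nᴴ) * (N * (S * Sᴴ)) by
      simp only [Matrix.mul_assoc], hPN', ← hNP', hNP, ← hPN,
      show Nᴴ * (S * Sᴴ) * (S * Sᴴ * N) = Nᴴ * (S * Sᴴ * (S * Sᴴ)) * N by
      simp only [Matrix.mul_assoc], hPP, Matrix.mul_assoc, hPN, Matrix.mul_sub, Matrix.mul_smul,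
      mul_vecMulVec, hNf', smul_vecMulVec, smul_smul]
    congr 2
    ring
  rw [localOp_conjTranspose, localOp_mul_fromBlocks, Matrix.mul_one, hN1, e2, e3, e4, hS,
    fromBlocks_add] at h3
  simpa using h3

/-! ### Normal completions of `3 × 3` matrices -/

/-- A binary Hermitian form with Gram matrix of diagonal `s` and off-diagonal `-c` is definite when
`s² > |c|²`; no sign of `s` is needed. -/
theorem eq_zero_of_form_eq_zero {s : ℝ} {c x y : ℂ} (hK : 0 < s ^ 2 - Complex.normSq c)
    (h : s * (x * star x) + s * (y * star y) - c * star x * y - star c * x * star y = 0) :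
    x = 0 ∧ y = 0 := by
  have h1 : Complex.normSq (s * x - c * y) +
      (s ^ 2 - Complex.normSq c) * Complex.normSq y = 0 := by
    have : ((Complex.normSq (s * x - c * y) +
      (s ^ 2 - Complex.normSq c) * Complex.normSq y : ℝ) : ℂ) = 0 := by
      push_cast
      simp only [← Complex.mul_conj, map_sub, map_mul, Complex.conj_ofReal]
      simp only [Complex.star_def] at h
      linear_combination (s : ℂ) * h
    exact_mod_cast this
  have hy : Complex.normSq y = 0 := by
    nlinarith [Complex.normSq_nonneg y, Complex.normSq_nonneg (s * x - c * y),
      mul_nonneg hK.le (Complex.normSq_nonneg y)]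
  have hx : Complex.normSq (s * x - c * y) = 0 := by rw [hy] at h1; linarith
  rw [Complex.normSq_eq_zero] at hx hy
  subst hy
  have hs : (s : ℂ) ≠ 0 := by
    rintro h0
    rw [Complex.ofReal_eq_zero] at h0
    subst h0
    nlinarith [Complex.normSq_nonneg c]
  simpa [hs] using hx

/-- The two relations force `|p| = |t|`: by the first, `(p, q)` and `(t, r)` are proportional, and
by the second, a definite Hermitian form takes the same value on both. -/
theorem mul_star_eq_of_relations {s : ℝ} {c p q r t : ℂ} (hK : 0 < s ^ 2 - Complex.normSq c)
    (h1 : p * r = q * t)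
    (h2 : s * (p * star p) + s * (q * star q) - c * star p * q - star c * p * star q =
      s * (t * star t) + s * (r * star r) - c * star t * r - star c * t * star r) :
    p * star p = t * star t := by
  have h1' : star p * star r = star q * star t := by rw [← star_mul', ← star_mul', h1]
  have h3 : (p * star p - t * star t) *
      (s * (t * star t) + s * (r * star r) - c * star t * r - star c * t * star r) = 0 := by
    linear_combination (t * star t) * h2 +
      (s * star p * star r - c * star p * star t) * h1 + (s * q * t - star c * p * t) * h1'
  rcases mul_eq_zero.mp h3 with h | h
  · exact sub_eq_zero.mp h
  · obtain ⟨rfl, rfl⟩ := eq_zero_of_form_eq_zero hK h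
    rw [h] at h2
    obtain ⟨rfl, rfl⟩ := eq_zero_of_form_eq_zero hK h2
    rfl

/-- The resolution of the identity of `ℂ³` by `u`, `v` and their conjugate cross product, cleared of
the Gram determinant of `u` and `v`. -/
theorem cross_resolution (u v : Fin 3 → ℂ) :
    ((star u ⬝ᵥ u) * (star v ⬝ᵥ v) - (star v ⬝ᵥ u) * (star u ⬝ᵥ v)) •
        (1 : Matrix (Fin 3) (Fin 3) ℂ) =
      vecMulVec (star (u ⨯₃ v)) (u ⨯₃ v) + (star u ⬝ᵥ u) • vecMulVec v (star v) +
        (star v ⬝ᵥ v) • vecMulVec u (star u) - (star v ⬝ᵥ u) • vecMulVec v (star u) -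
        (star u ⬝ᵥ v) • vecMulVec u (star v) := by
  ext i j
  fin_cases i <;> fin_cases j <;>
    simp [vecMulVec_apply, cross_apply, dotProduct, Fin.sum_univ_three] <;> ring

theorem star_dotProduct_conjTranspose_mulVec {n : Type*} [Fintype n] (B : Matrix n n ℂ)
    (x y : n → ℂ) : star x ⬝ᵥ Bᴴ *ᵥ y = star (star y ⬝ᵥ B *ᵥ x) := by
  rw [dotProduct_mulVec, ← star_mulVec, star_dotProduct]

theorem star_mulVec_dotProduct {n : Type*} [Fintype n] (B : Matrix n n ℂ)
    (x y : n → ℂ) : star (B *ᵥ x) ⬝ᵥ y = star x ⬝ᵥ Bᴴ *ᵥ y := by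
  rw [star_mulVec, ← dotProduct_mulVec]

/-- The self-commutator of `B` has trace zero against every matrix commuting with `B`. -/
theorem dotProduct_self_eq_of_selfCommutator {n : Type*} [Fintype n] {B X : Matrix n n ℂ}
    {u v : n → ℂ} (hD : Bᴴ * B + vecMulVec u (star u) = B * Bᴴ + vecMulVec v (star v))
    (hX : B * X = X * B) : star v ⬝ᵥ X *ᵥ v = star u ⬝ᵥ X *ᵥ u := by
  have key (w : n → ℂ) : (X * vecMulVec w (star w)).trace = star w ⬝ᵥ X *ᵥ w := by
    rw [mul_vecMulVec, trace_vecMulVec, dotProduct_comm]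
  have h := congrArg (fun M => (X * M).trace) hD
  simp only [Matrix.mul_add, trace_add, key] at h
  have h2 : (X * (Bᴴ * B)).trace = (X * (B * Bᴴ)).trace := by
    rw [← Matrix.mul_assoc, trace_mul_comm, ← Matrix.mul_assoc, hX, Matrix.mul_assoc]
  rw [h2] at h
  exact (add_left_cancel h).symm

/-- The scalar equation fixing the corner entry of the normal completion. -/
theorem exists_corner {s : ℝ} {c ω κ : ℂ} (hK : 0 < s ^ 2 - Complex.normSq c)
    (hω : ω * star ω = 1) : ∃ d : ℂ, star d * s - ω * c * d = κ := by
  have hK' : (s : ℂ) ^ 2 - c * star c ≠ 0 := by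
    rw [Complex.star_def, Complex.mul_conj]
    exact_mod_cast hK.ne'
  refine ⟨(s * star κ + star ω * star c * κ) / (s ^ 2 - c * star c), ?_⟩
  have h1 : star ((s * star κ + star ω * star c * κ) / (s ^ 2 - c * star c)) =
      (s * κ + ω * c * star κ) / (s ^ 2 - c * star c) := by
    simp only [Complex.star_def, map_div₀, map_add, map_mul, map_sub, map_pow, Complex.conj_ofReal,
      Complex.conj_conj, mul_comm]
  rw [h1]
  field_simp
  linear_combination (-c * star c * κ) * hω

/-- A `3 × 3` matrix `B` whose self-commutator is `v v* - u u*` with `u`, `v` linearly independent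
has a normal completion of size four, with last column `v`, last row `w*` and corner `d`, where `w` is
`u` up to a phase. The conclusion lists the equations between the blocks that say it is normal. -/
theorem exists_normal_completion {B : Matrix (Fin 3) (Fin 3) ℂ} {u v : Fin 3 → ℂ}
    (hD : Bᴴ * B + vecMulVec u (star u) = B * Bᴴ + vecMulVec v (star v))
    (hK : (star u ⬝ᵥ u) * (star v ⬝ᵥ v) - (star v ⬝ᵥ u) * (star u ⬝ᵥ v) ≠ 0) :
    ∃ (w : Fin 3 → ℂ) (d : ℂ), vecMulVec w (star w) = vecMulVec u (star u) ∧
      star v ⬝ᵥ v = star w ⬝ᵥ w ∧ Bᴴ *ᵥ v + d • w = B *ᵥ w + star d • v := by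
  set h := star (u ⨯₃ v) with hh
  set c := star v ⬝ᵥ u with hc
  have hc' : star u ⬝ᵥ v = star c := by rw [hc, star_dotProduct]
  obtain ⟨s, -, hs⟩ := exists_ofReal_of_nonneg (dotProduct_star_self_nonneg u)
  have hvu : star v ⬝ᵥ v = star u ⬝ᵥ u := by
    simpa using dotProduct_self_eq_of_selfCommutator (X := 1) hD (by simp)
  have hvs : star v ⬝ᵥ v = s := hvu.trans hs
  have hτ := dotProduct_self_eq_of_selfCommutator (X := B) hD rfl
  have hτ2 := dotProduct_self_eq_of_selfCommutator (X := B * B) hD (by rw [Matrix.mul_assoc])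
  have hres := cross_resolution u v
  have hhh : star h ⬝ᵥ h = (star u ⬝ᵥ u) * (star v ⬝ᵥ v) - (star v ⬝ᵥ u) * (star u ⬝ᵥ v) := by
    simp [hh, cross_apply, dotProduct, Fin.sum_univ_three]
    ring
  have huh : star u ⬝ᵥ h = 0 := by
    simp [hh, cross_apply, dotProduct, Fin.sum_univ_three]
    ring
  have hvh : star v ⬝ᵥ h = 0 := by
    simp [hh, cross_apply, dotProduct, Fin.sum_univ_three]
    ring
  rw [show u ⨯₃ v = star h from (star_star _).symm, star_star] at hres
  rw [hvs, hs, hc', ← hc] at hres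
  rw [hvs, hs, hc'] at hK hhh
  -- the resolution of the identity by `h`, `u`, `v`, as an identity of inner products
  have hR (x y : Fin 3 → ℂ) : ((s : ℂ) * s - c * star c) * (star x ⬝ᵥ y) =
      (star x ⬝ᵥ h) * (star h ⬝ᵥ y) + s * ((star x ⬝ᵥ v) * (star v ⬝ᵥ y)) +
        s * ((star x ⬝ᵥ u) * (star u ⬝ᵥ y)) - c * ((star x ⬝ᵥ v) * (star u ⬝ᵥ y)) -
        star c * ((star x ⬝ᵥ u) * (star v ⬝ᵥ y)) := by
    have := congrArg (fun M => star x ⬝ᵥ M *ᵥ y) hres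
    simp only [smul_mulVec, one_mulVec, add_mulVec, sub_mulVec, vecMulVec_mulVec, dotProduct_add,
      dotProduct_sub, dotProduct_smul, smul_eq_mul, op_smul_eq_smul] at this
    rw [this]
    ring
  have hKpos : 0 < s ^ 2 - Complex.normSq c := by
    have h1 : (s : ℂ) * s - c * star c = ((s ^ 2 - Complex.normSq c : ℝ) : ℂ) := by
      rw [Complex.star_def, Complex.mul_conj]
      push_cast
      ring
    have h2 := dotProduct_star_self_nonneg h
    rw [hhh, h1] at h2
    rw [h1] at hK
    exact lt_of_le_of_ne (by exact_mod_cast h2) (fun h => hK (by rw [← h, Complex.ofReal_zero]))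
  -- `h` is in the kernel of the self-commutator
  have hker : star h ⬝ᵥ Bᴴ *ᵥ B *ᵥ h = star h ⬝ᵥ B *ᵥ Bᴴ *ᵥ h := by
    have := congrArg (fun M => star h ⬝ᵥ M *ᵥ h) hD
    simpa [add_mulVec, vecMulVec_mulVec, huh, hvh, ← mulVec_mulVec] using this
  -- `e1`, `e2` expand `v* B² v = u* B² u`, and `e3`, `e4` expand `‖B h‖² = ‖Bᴴ h‖²`
  have e1 := hR (Bᴴ *ᵥ v) (B *ᵥ v)
  have e2 := hR (Bᴴ *ᵥ u) (B *ᵥ u)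
  have e3 := hR (B *ᵥ h) (B *ᵥ h)
  have e4 := hR (Bᴴ *ᵥ h) (Bᴴ *ᵥ h)
  simp only [star_mulVec_dotProduct, conjTranspose_conjTranspose] at e1 e2 e3 e4
  rw [hker, e4] at e3
  rw [← mulVec_mulVec, ← mulVec_mulVec] at hτ2
  rw [hτ2, e2] at e1
  simp only [star_dotProduct_conjTranspose_mulVec] at e1 e2 e3 e4
  rw [hτ] at e1
  have habs := mul_star_eq_of_relations (p := star v ⬝ᵥ B *ᵥ h) (q := star u ⬝ᵥ B *ᵥ h)
    (r := star h ⬝ᵥ B *ᵥ v) (t := star h ⬝ᵥ B *ᵥ u) hKpos (by linear_combination -e1)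
    (by linear_combination -e3)
  -- the phase matching the components along `h`
  obtain ⟨ω, hω, hp⟩ : ∃ ω : ℂ, ω * star ω = 1 ∧
      star (star v ⬝ᵥ B *ᵥ h) = ω * (star h ⬝ᵥ B *ᵥ u) := by
    generalize star v ⬝ᵥ B *ᵥ h = p at habs
    generalize star h ⬝ᵥ B *ᵥ u = t at habs
    by_cases ht : t = 0
    · refine ⟨1, by simp, ?_⟩
      subst ht
      rw [zero_mul, mul_eq_zero, star_eq_zero, or_self] at habs
      simp [habs]
    · refine ⟨star p / t, ?_, by field_simp⟩
      have ht' : star t ≠ 0 := by rwa [Ne, star_eq_zero]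
      rw [star_div₀, star_star]
      field_simp
      linear_combination habs
  -- the components of the required equation along `v` and `u` are conjugate to each other, so the
  -- single equation for `d` settles both
  obtain ⟨d, hd⟩ := exists_corner (c := c) (ω := ω)
    (κ := star (star u ⬝ᵥ B *ᵥ u) - ω * (star v ⬝ᵥ B *ᵥ u)) hKpos hω
  have hsr : star (s : ℂ) = s := Complex.conj_ofReal s
  have hd' := congrArg star hd
  simp only [star_sub, star_mul', star_star, hsr] at hd'
  refine ⟨ω • u, d, ?_, ?_, ?_⟩
  · rw [star_smul, smul_vecMulVec, vecMulVec_smul, smul_smul, hω, one_smul]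
  · rw [hvu, star_smul, smul_dotProduct, dotProduct_smul, smul_smul, mul_comm, hω, one_smul]
  · have hhu : star h ⬝ᵥ u = 0 := by rw [star_dotProduct, huh, star_zero]
    have hhv : star h ⬝ᵥ v = 0 := by rw [star_dotProduct, hvh, star_zero]
    have key : ∀ T, T = Bᴴ *ᵥ v + d • ω • u - (B *ᵥ (ω • u) + star d • v) → T = 0 := by
      intro T hT
      have hx (x : Fin 3 → ℂ) : star x ⬝ᵥ T = star (star v ⬝ᵥ B *ᵥ x) + d * (ω * (star x ⬝ᵥ u)) -
          (ω * (star x ⬝ᵥ B *ᵥ u) + star d * (star x ⬝ᵥ v)) := by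
        simp only [hT, dotProduct_add, dotProduct_sub, dotProduct_smul, smul_eq_mul, mulVec_smul,
          star_dotProduct_conjTranspose_mulVec]
      have h1 : star h ⬝ᵥ T = 0 := by
        rw [hx, hp, hhu, hhv]
        ring
      have h2 : star v ⬝ᵥ T = 0 := by
        rw [hx, hτ, hvs, ← hc]
        linear_combination -hd
      have h3 : star u ⬝ᵥ T = 0 := by
        rw [hx, hs, hc']
        linear_combination ω * hd' + (star c * star d - star (star v ⬝ᵥ B *ᵥ u)) * hω
      have := hR T T
      rw [h1, h2, h3] at this
      simp only [mul_zero, add_zero, sub_zero, mul_eq_zero, hK, false_or] at this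
      exact dotProduct_star_self_eq_zero.mp this
    exact sub_eq_zero.mp (key _ rfl)

/-! ### PPT operators on a qubit and a system of dimension at most three -/

/-- Compressions of normal matrices define separable operators. -/
theorem fromBlocks_mem_sepCone_of_dilation {n κ : Type} [DecidableEq n] [Fintype κ] [DecidableEq κ]
    {N : Matrix κ κ ℂ} (hN : Nᴴ * N = N * Nᴴ) {J : Matrix κ n ℂ} (hJ : Jᴴ * J = 1) :
    fromBlocks 1 (Jᴴ * N * J) (Jᴴ * N * J)ᴴ (Jᴴ * (Nᴴ * N) * J) ∈ sepCone n := by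
  have h := localOp_mul_mem_sepCone (fromBlocks_mem_sepCone_of_normal _ κ N rfl hN) Jᴴ
  rw [localOp_conjTranspose, localOp_mul_fromBlocks, Matrix.mul_one, conjTranspose_conjTranspose,
    hJ] at h
  simpa only [conjTranspose_mul, conjTranspose_conjTranspose, Matrix.mul_assoc] using h

/-- Linearly dependent vectors of equal norm define the same rank-one operator: the squared
Hilbert–Schmidt norm of the difference of the two operators is twice the Gram determinant. -/
theorem vecMulVec_eq_of_gram_eq_zero [Fintype n] {u v : n → ℂ} (huv : star v ⬝ᵥ v = star u ⬝ᵥ u)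
    (hK : (star u ⬝ᵥ u) * (star v ⬝ᵥ v) - (star v ⬝ᵥ u) * (star u ⬝ᵥ v) = 0) :
    vecMulVec u (star u) = vecMulVec v (star v) := by
  rw [← sub_eq_zero, ← trace_conjTranspose_mul_self_eq_zero_iff]
  simp only [conjTranspose_sub, conjTranspose_vecMulVec, star_star, Matrix.sub_mul, Matrix.mul_sub,
    vecMulVec_mul_vecMulVec, trace_sub, vecMulVec_smul, trace_smul, trace_vecMulVec, smul_eq_mul]
  rw [dotProduct_comm u, dotProduct_comm v, dotProduct_comm v, dotProduct_comm u, huv] at *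
  linear_combination 2 * hK

/-- Separability when both Schur complements have rank one. -/
theorem fromBlocks_mem_sepCone_of_rank_one {B C : Matrix (Fin 3) (Fin 3) ℂ} {u v : Fin 3 → ℂ}
    (hu : C = Bᴴ * B + vecMulVec u (star u)) (hv : C = B * Bᴴ + vecMulVec v (star v)) :
    fromBlocks 1 B Bᴴ C ∈ sepCone (Fin 3) := by
  have hD := hu.symm.trans hv
  by_cases hK : (star u ⬝ᵥ u) * (star v ⬝ᵥ v) - (star v ⬝ᵥ u) * (star u ⬝ᵥ v) = 0
  · have hvu : star v ⬝ᵥ v = star u ⬝ᵥ u := by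
      simpa using dotProduct_self_eq_of_selfCommutator (X := 1) hD (by simp)
    rw [vecMulVec_eq_of_gram_eq_zero hvu hK] at hD
    have h := add_mem (fromBlocks_mem_sepCone_of_normal _ _ B rfl (add_right_cancel hD))
      (fromBlocks_zero_vecMulVec_mem_sepCone zero_le_one u)
    rw [fromBlocks_add] at h
    simpa [hu] using h
  · obtain ⟨w, d, hw, hvw, hd⟩ := exists_normal_completion hD hK
    -- the normal completion, and the inclusion of the first three coordinates
    let N : Matrix (Fin 3 ⊕ Unit) (Fin 3 ⊕ Unit) ℂ :=
      fromBlocks B (replicateCol Unit v) (replicateRow Unit (star w)) (of fun _ _ => d)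
    let J : Matrix (Fin 3 ⊕ Unit) (Fin 3) ℂ := fromRows 1 0
    have hNN : Nᴴ * N = fromBlocks C (replicateCol Unit (Bᴴ *ᵥ v + d • w))
        (replicateRow Unit (star (Bᴴ *ᵥ v + d • w))) (of fun _ _ => star w ⬝ᵥ w + d * star d) := by
      rw [fromBlocks_conjTranspose, fromBlocks_multiply, fromBlocks_inj]
      refine ⟨?_, ?_, ?_, ?_⟩
      · rw [hu, ← hw]
        ext i j
        simp [mul_apply, vecMulVec_apply]
      · ext i j
        simp [mul_apply, mulVec, dotProduct, mul_comm]
      · ext i j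
        simp [mul_apply, mulVec, dotProduct, mul_comm]
      · ext i j
        rw [← hvw]
        simp [mul_apply, dotProduct, mul_comm]
    have hNN' : N * Nᴴ = fromBlocks C (replicateCol Unit (Bᴴ *ᵥ v + d • w))
        (replicateRow Unit (star (Bᴴ *ᵥ v + d • w))) (of fun _ _ => star w ⬝ᵥ w + d * star d) := by
      rw [fromBlocks_conjTranspose, fromBlocks_multiply, fromBlocks_inj, hd]
      refine ⟨?_, ?_, ?_, ?_⟩
      · rw [hv]
        ext i j
        simp [mul_apply, vecMulVec_apply]
      · ext i j
        simp [mul_apply, mulVec, dotProduct, mul_comm]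
      · ext i j
        simp [mul_apply, mulVec, dotProduct, mul_comm]
      · ext i j
        simp [mul_apply, dotProduct, mul_comm]
    have hcomp (X : Matrix (Fin 3 ⊕ Unit) (Fin 3 ⊕ Unit) ℂ) : Jᴴ * X * J = X.toBlocks₁₁ := by
      rw [← fromBlocks_toBlocks X]
      simp [J, conjTranspose_fromRows_eq_fromCols_conjTranspose, fromCols_mul_fromBlocks,
        fromCols_mul_fromRows]
    have h := fromBlocks_mem_sepCone_of_dilation (hNN.trans hNN'.symm) (J := J)
      (by simp [J, conjTranspose_fromRows_eq_fromCols_conjTranspose, fromCols_mul_fromRows])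
    rw [hNN, hcomp, hcomp] at h
    simpa [N] using h

/-- The rank of a block matrix is at least that of its Schur complement plus the block size. -/
theorem card_add_rank_le [Fintype n] [DecidableEq n] {B C : Matrix n n ℂ}
    (h : (fromBlocks 1 B Bᴴ C).PosSemidef) :
    Fintype.card n + (C - Bᴴ * B).rank ≤ (fromBlocks 1 B Bᴴ C).rank := by
  obtain ⟨V, hV⟩ := exists_eq_mul_conjTranspose_rank h
  rw [← fromRows_toRows V, conjTranspose_fromRows_eq_fromCols_conjTranspose,
    fromRows_mul_fromCols, fromBlocks_inj] at hV
  obtain ⟨h1, h2, h3, h4⟩ := hV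
  generalize V.toRows₁ = V₁ at *
  generalize V.toRows₂ = V₂ at *
  -- the rows of `V₂ - Bᴴ V₁` are orthogonal to those of `V₁`
  have h5 : V₁ * (V₂ - Bᴴ * V₁)ᴴ = 0 := by
    rw [conjTranspose_sub, conjTranspose_mul, conjTranspose_conjTranspose, Matrix.mul_sub,
      ← Matrix.mul_assoc, ← h1, ← h2, Matrix.one_mul, sub_self]
  have h6 : (V₂ - Bᴴ * V₁) * (V₂ - Bᴴ * V₁)ᴴ = C - Bᴴ * B := by
    rw [Matrix.sub_mul, Matrix.mul_assoc, h5, Matrix.mul_zero, sub_zero, conjTranspose_sub,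
      conjTranspose_mul, conjTranspose_conjTranspose, Matrix.mul_sub, ← Matrix.mul_assoc, ← h3,
      ← h4]
  have h7 := rank_add_rank_le_card_of_mul_eq_zero h5
  rw [rank_conjTranspose, ← rank_self_mul_conjTranspose (V₂ - _), h6,
    ← rank_self_mul_conjTranspose V₁, ← h1, rank_one, Fintype.card_fin] at h7
  exact h7

theorem exists_eq_vecMulVec_of_rank_eq_one [Fintype n] {M : Matrix n n ℂ} (hM : M.PosSemidef)
    (h : M.rank = 1) : ∃ u, M = vecMulVec u (star u) := by
  have h1 := exists_eq_mul_conjTranspose_rank hM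
  rw [h] at h1
  obtain ⟨V, hV⟩ := h1
  refine ⟨fun i => V i 0, ?_⟩
  rw [hV]
  ext i j
  simp [mul_apply, vecMulVec_apply]

/-- The case where the first block is the identity and `ρ` has small rank: the Schur complements
both vanish, or both have rank one and `N = 3`. -/
theorem IsPPT.mem_sepCone_of_rank_le {N : ℕ} (hN : N ≤ 3) {B C : Matrix (Fin N) (Fin N) ℂ}
    (hρ : IsPPT (fromBlocks 1 B Bᴴ C))
    (hr : (fromBlocks 1 B Bᴴ C).rank ^ 2 + (blockTranspose (fromBlocks 1 B Bᴴ C)).rank ^ 2 ≤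
      4 * N ^ 2 + 1) : fromBlocks 1 B Bᴴ C ∈ sepCone (Fin N) := by
  have hΓ : (fromBlocks 1 Bᴴ Bᴴᴴ C).PosSemidef := by
    rw [conjTranspose_conjTranspose]; exact hρ.2
  let _ : Invertible (1 : Matrix (Fin N) (Fin N) ℂ) := invertibleOne
  have hU : (C - Bᴴ * B).PosSemidef := by
    simpa using (PosDef.one.fromBlocks₁₁ B C).mp hρ.1
  have hV : (C - B * Bᴴ).PosSemidef := by
    simpa using (PosDef.one.fromBlocks₁₁ Bᴴ C).mp hΓ
  have htr : (C - Bᴴ * B).trace = (C - B * Bᴴ).trace := by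
    rw [trace_sub, trace_sub, trace_mul_comm]
  have hr1 := card_add_rank_le hρ.1
  have hr2 := card_add_rank_le hΓ
  rw [conjTranspose_conjTranspose] at hr2
  rw [blockTranspose_fromBlocks] at hr
  rw [Fintype.card_fin] at hr1 hr2
  by_cases hU0 : C - Bᴴ * B = 0
  · have hV0 : C - B * Bᴴ = 0 := by rw [← hV.trace_eq_zero_iff, ← htr, hU0, trace_zero]
    rw [sub_eq_zero] at hU0 hV0
    rw [hU0]
    exact fromBlocks_mem_sepCone_of_normal _ _ B rfl (hU0.symm.trans hV0)
  · have hV0 : C - B * Bᴴ ≠ 0 := by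
      rwa [Ne, ← hV.trace_eq_zero_iff, ← htr, hU.trace_eq_zero_iff]
    have h1 : 1 ≤ (C - Bᴴ * B).rank := Nat.one_le_iff_ne_zero.mpr (mt eq_zero_of_rank_eq_zero hU0)
    have h2 : 1 ≤ (C - B * Bᴴ).rank := Nat.one_le_iff_ne_zero.mpr (mt eq_zero_of_rank_eq_zero hV0)
    have h3 : (N + (C - Bᴴ * B).rank) ^ 2 + (N + (C - B * Bᴴ).rank) ^ 2 ≤ 4 * N ^ 2 + 1 :=
      (add_le_add (Nat.pow_le_pow_left hr1 2) (Nat.pow_le_pow_left hr2 2)).trans hr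
    have h4 : N = 3 ∧ (C - Bᴴ * B).rank = 1 ∧ (C - B * Bᴴ).rank = 1 := by
      generalize (C - Bᴴ * B).rank = a at *
      generalize (C - B * Bᴴ).rank = b at *
      have ha : a ≤ 3 := by
        by_contra! h
        nlinarith
      have hb : b ≤ 3 := by
        by_contra! h
        nlinarith
      interval_cases N <;> interval_cases a <;> interval_cases b <;> simp at h3 ⊢
    obtain ⟨rfl, ha, hb⟩ := h4
    obtain ⟨u, hu⟩ := exists_eq_vecMulVec_of_rank_eq_one hU ha
    obtain ⟨v, hv⟩ := exists_eq_vecMulVec_of_rank_eq_one hV hb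
    exact fromBlocks_mem_sepCone_of_rank_one (by rw [← hu]; abel) (by rw [← hv]; abel)

/-- Størmer and Woronowicz: PPT operators on a qubit and a system of dimension at most three are
separable. -/
theorem IsPPT.mem_sepCone (N : ℕ) : N ≤ 3 → ∀ ρ : Matrix (Fin N ⊕ Fin N) (Fin N ⊕ Fin N) ℂ,
    IsPPT ρ → ρ ∈ sepCone (Fin N) := by
  induction N using Nat.strong_induction_on with
  | _ N ih =>
  intro hN ρ
  induction hR : ρ.rank + (blockTranspose ρ).rank using Nat.strong_induction_on generalizing ρ with
  | _ R ihR =>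
  intro hρ
  subst hR
  by_cases hlarge : 4 * N ^ 2 + 1 < ρ.rank ^ 2 + (blockTranspose ρ).rank ^ 2
  · obtain ⟨σ, τ, hσ, hτ, h, h1, h2⟩ := hρ.exists_add_of_rank_large (by rwa [Fintype.card_fin])
    have := add_mem (ihR _ h1 σ rfl hσ) (ihR _ h2 τ rfl hτ)
    rwa [← h] at this
  obtain ⟨A, B, C, rfl, hA, hC⟩ := hρ.exists_fromBlocks
  by_cases hy : ∃ y, y ≠ 0 ∧ A *ᵥ y = 0
  · obtain ⟨y, hy, hAy⟩ := hy
    refine hρ.mem_sepCone_of_mulVec_eq_zero hy hAy fun r hr σ hσ => ?_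
    rw [Fintype.card_fin] at hr
    exact ih r hr (hr.le.trans hN) σ hσ
  -- normalize the first block to the identity
  have hdet : A.det ≠ 0 := fun h => hy (exists_mulVec_eq_zero_iff.mpr h)
  obtain ⟨S, hS⟩ := exists_eq_conjTranspose_mul_self hA
  have hSdet : IsUnit S.det := by
    rw [isUnit_iff_ne_zero]
    rintro h
    rw [hS, det_mul, h, mul_zero] at hdet
    exact hdet rfl
  have hST : S * S⁻¹ = 1 := mul_nonsing_inv S hSdet
  have hTS : S⁻¹ * S = 1 := nonsing_inv_mul S hSdet
  have hSTh : (S⁻¹)ᴴ * Sᴴ = 1 := by rw [← conjTranspose_mul, hST, conjTranspose_one]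
  have hTSh : Sᴴ * (S⁻¹)ᴴ = 1 := by rw [← conjTranspose_mul, hTS, conjTranspose_one]
  have hσ := hρ.map_localOp (S⁻¹)ᴴ
  have hr1 : (localOp (S⁻¹)ᴴ * fromBlocks A B Bᴴ C * (localOp (S⁻¹)ᴴ)ᴴ).rank ≤
      (fromBlocks A B Bᴴ C).rank := (rank_mul_le_left _ _).trans (rank_mul_le_right _ _)
  have hr2 : (blockTranspose (localOp (S⁻¹)ᴴ * fromBlocks A B Bᴴ C * (localOp (S⁻¹)ᴴ)ᴴ)).rank ≤
      (blockTranspose (fromBlocks A B Bᴴ C)).rank := by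
    rw [blockTranspose_localOp_mul]
    exact (rank_mul_le_left _ _).trans (rank_mul_le_right _ _)
  have hback : localOp Sᴴ * (localOp (S⁻¹)ᴴ * fromBlocks A B Bᴴ C * (localOp (S⁻¹)ᴴ)ᴴ) *
      (localOp Sᴴ)ᴴ = fromBlocks A B Bᴴ C := by
    calc _ = (localOp Sᴴ * localOp (S⁻¹)ᴴ) * fromBlocks A B Bᴴ C *
          ((localOp (S⁻¹)ᴴ)ᴴ * (localOp Sᴴ)ᴴ) := by simp only [Matrix.mul_assoc]
      _ = _ := by
        rw [localOp_conjTranspose, localOp_conjTranspose, localOp_mul_localOp,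
          localOp_mul_localOp, hTSh, conjTranspose_conjTranspose, conjTranspose_conjTranspose, hTS,
          localOp_one, Matrix.one_mul, Matrix.mul_one]
  have hblocks : localOp (S⁻¹)ᴴ * fromBlocks A B Bᴴ C * (localOp (S⁻¹)ᴴ)ᴴ =
      fromBlocks 1 ((S⁻¹)ᴴ * B * S⁻¹) ((S⁻¹)ᴴ * B * S⁻¹)ᴴ ((S⁻¹)ᴴ * C * S⁻¹) := by
    have h1 : (S⁻¹)ᴴ * A * S⁻¹ = 1 := by
      rw [hS, ← Matrix.mul_assoc, hSTh, Matrix.one_mul, hST]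
    rw [localOp_conjTranspose, conjTranspose_conjTranspose, localOp_mul_fromBlocks, h1]
    simp only [conjTranspose_mul, conjTranspose_conjTranspose, Matrix.mul_assoc]
  rw [← hback]
  apply localOp_mul_mem_sepCone
  rw [hblocks] at hσ hr1 hr2 ⊢
  exact hσ.mem_sepCone_of_rank_le hN
    ((add_le_add (Nat.pow_le_pow_left hr1 2) (Nat.pow_le_pow_left hr2 2)).trans (not_lt.mp hlarge))

/-! ### Separability of bipartite operators -/

theorem IsSeparable.zero : IsSeparable (0 : Matrix (m × n) (m × n) ℂ) :=
  ⟨0, fun _ => 0, fun _ => 0, fun _ => PosSemidef.zero, fun _ => PosSemidef.zero, by simp⟩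

theorem IsSeparable.add {σ τ : Matrix (m × n) (m × n) ℂ} (hσ : IsSeparable σ)
    (hτ : IsSeparable τ) : IsSeparable (σ + τ) := by
  obtain ⟨N, A, B, hA, hB, rfl⟩ := hσ
  obtain ⟨N', A', B', hA', hB', rfl⟩ := hτ
  refine ⟨N + N', Fin.append A A', Fin.append B B', ?_, ?_, ?_⟩
  · intro i
    refine Fin.addCases (fun i => ?_) (fun i => ?_) i
    · simpa using hA i
    · simpa using hA' i
  · intro i
    refine Fin.addCases (fun i => ?_) (fun i => ?_) i
    · simpa using hB i
    · simpa using hB' i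
  · rw [Fin.sum_univ_add]
    simp

theorem IsSeparable.sum {ι : Type*} (s : Finset ι) {σ : ι → Matrix (m × n) (m × n) ℂ}
    (h : ∀ i, IsSeparable (σ i)) : IsSeparable (∑ i ∈ s, σ i) :=
  Finset.sum_induction σ IsSeparable (fun _ _ => IsSeparable.add) IsSeparable.zero fun i _ => h i

/-- The local operator `K ⊗ F`, where `K` maps a qubit to `ℂᵐ` and the domain `ℂ² ⊗ ℂᵏ` is written
as a direct sum. -/
def qubitKronecker (K : Matrix m (Fin 2) ℂ) (F : Matrix n k ℂ) : Matrix (m × n) (k ⊕ k) ℂ :=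
  of fun u => Sum.elim (fun l => K u.1 0 * F u.2 l) (fun l => K u.1 1 * F u.2 l)

theorem qubitKronecker_mul_localOp [Fintype k] (K : Matrix m (Fin 2) ℂ) (F : Matrix n k ℂ)
    (G : Matrix k p ℂ) : qubitKronecker K F * localOp G = qubitKronecker K (F * G) := by
  ext u (j | j) <;>
    simp [qubitKronecker, localOp, mul_apply, Finset.mul_sum, mul_assoc]

theorem isSeparable_vecMulVec [Finite m] [Finite n] (a : m → ℂ) (b : n → ℂ) :
    IsSeparable (vecMulVec (fun u : m × n => a u.1 * b u.2) (star fun u => a u.1 * b u.2)) :=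
  ⟨1, fun _ => vecMulVec a (star a), fun _ => vecMulVec b (star b),
    fun _ => posSemidef_vecMulVec_self_star a, fun _ => posSemidef_vecMulVec_self_star b, by
      ext u v
      simp [vecMulVec_apply, kroneckerMap_apply]
      ring⟩

theorem isSeparable_of_mem_sepCone [Finite m] [Finite n] [Fintype k] {ρ : Matrix (k ⊕ k) (k ⊕ k) ℂ}
    (h : ρ ∈ sepCone k) (K : Matrix m (Fin 2) ℂ) (F : Matrix n k ℂ) :
    IsSeparable (qubitKronecker K F * ρ * (qubitKronecker K F)ᴴ) := by
  induction h using AddSubmonoid.closure_induction with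
  | mem M hM =>
    obtain ⟨x, y, f, rfl⟩ := hM
    have hv : qubitKronecker K F *ᵥ Sum.elim (x • f) (y • f) =
        fun u => (K u.1 0 * x + K u.1 1 * y) * (F *ᵥ f) u.2 := by
      funext u
      simp only [qubitKronecker, mulVec, dotProduct, of_apply, Fintype.sum_sum_type, Sum.elim_inl,
        Sum.elim_inr, Pi.smul_apply, smul_eq_mul, Finset.mul_sum, ← Finset.sum_add_distrib]
      exact Finset.sum_congr rfl fun _ _ => by ring
    rw [mul_vecMulVec, vecMulVec_mul, ← star_mulVec, hv]
    exact isSeparable_vecMulVec (fun i => K i 0 * x + K i 1 * y) (F *ᵥ f)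
  | zero => simpa using IsSeparable.zero
  | add a b _ _ ha hb =>
    rw [Matrix.mul_add, Matrix.add_mul]
    exact ha.add hb

/-! ### PPT maps on vectors of Schmidt rank two -/

/-- The operator `(id₂ ⊗ φ)(|b⟩⟨b|)` for the vector `b = e₀ ⊗ b 0 + e₁ ⊗ b 1` of `ℂ² ⊗ ℂᵖ`. -/
def qubitImage (φ : Matrix p p ℂ →ₗ[ℂ] Matrix n n ℂ) (b : Fin 2 → p → ℂ) :
    Matrix (n ⊕ n) (n ⊕ n) ℂ :=
  fromBlocks (φ (vecMulVec (b 0) (star (b 0)))) (φ (vecMulVec (b 0) (star (b 1))))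
    (φ (vecMulVec (b 1) (star (b 0)))) (φ (vecMulVec (b 1) (star (b 1))))

theorem qubitImage_eq_submatrix (φ : Matrix p p ℂ →ₗ[ℂ] Matrix n n ℂ) (b : Fin 2 → p → ℂ) :
    qubitImage φ b = (ampliation φ (vecMulVec (fun u : Fin 2 × p => b u.1 u.2)
      (star fun u => b u.1 u.2))).submatrix (Sum.elim (fun i => (0, i)) (fun i => (1, i)))
      (Sum.elim (fun i => (0, i)) (fun i => (1, i))) := by
  ext (i | i) (j | j) <;> rfl

theorem blockTranspose_qubitImage (φ : Matrix p p ℂ →ₗ[ℂ] Matrix n n ℂ) (b : Fin 2 → p → ℂ) :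
    blockTranspose (qubitImage φ b) =
      (qubitImage ((transposeLinearEquiv n n ℂ ℂ).toLinearMap ∘ₗ φ) b)ᵀ := by
  ext (i | i) (j | j) <;> rfl

theorem IsPPTMap.isPPT_qubitImage [Fintype p] {φ : Matrix p p ℂ →ₗ[ℂ] Matrix n n ℂ}
    (hφ : IsPPTMap φ) (b : Fin 2 → p → ℂ) : IsPPT (qubitImage φ b) := by
  refine ⟨?_, ?_⟩
  · rw [qubitImage_eq_submatrix]
    exact (hφ.1 2 _ (posSemidef_vecMulVec_self_star _)).submatrix _
  · rw [blockTranspose_qubitImage, posSemidef_transpose_iff, qubitImage_eq_submatrix]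
    exact (hφ.2 2 _ (posSemidef_vecMulVec_self_star _)).submatrix _

/-- The vector `a = (K ⊗ 1) b` has Schmidt rank at most two; if `φ` takes its values in the block of
`P`, then `(id ⊗ φ)(|a⟩⟨a|)` comes from the qubit image of `b` by the local operator `K ⊗ P`. -/
theorem ampliation_vecMulVec_eq [Fintype n] [DecidableEq n] {φ : Matrix p p ℂ →ₗ[ℂ] Matrix n n ℂ}
    {P : Matrix n n ℂ} (hP : Pᴴ = P) (hφ : ∀ X, φ X = P * φ X * P) (K : Matrix m (Fin 2) ℂ)
    (b : Fin 2 → p → ℂ) :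
    ampliation φ (vecMulVec (fun u : m × p => K u.1 0 * b 0 u.2 + K u.1 1 * b 1 u.2)
      (star fun u => K u.1 0 * b 0 u.2 + K u.1 1 * b 1 u.2)) =
      qubitKronecker K P * qubitImage φ b * (qubitKronecker K P)ᴴ := by
  have hrow (A B C D : Matrix n n ℂ) (u v : m × n) :
      (qubitKronecker K P * fromBlocks A B C D * (qubitKronecker K P)ᴴ) u v =
        K u.1 0 * star (K v.1 0) * (P * A * P) u.2 v.2 +
          K u.1 0 * star (K v.1 1) * (P * B * P) u.2 v.2 +
          K u.1 1 * star (K v.1 0) * (P * C * P) u.2 v.2 +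
          K u.1 1 * star (K v.1 1) * (P * D * P) u.2 v.2 := by
    have h1 : qubitKronecker K P * fromBlocks A B C D * (qubitKronecker K P)ᴴ =
        qubitKronecker K (1 : Matrix n n ℂ) *
          fromBlocks (P * A * P) (P * B * P) (P * C * P) (P * D * P) *
          (qubitKronecker K (1 : Matrix n n ℂ))ᴴ := by
      have h2 : qubitKronecker K P = qubitKronecker K (1 : Matrix n n ℂ) * localOp P := by
        rw [qubitKronecker_mul_localOp, Matrix.one_mul]
      rw [h2, conjTranspose_mul, localOp_conjTranspose, hP, ← localOp_mul_fromBlocks]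
      simp only [Matrix.mul_assoc]
    rw [h1]
    simp only [qubitKronecker, mul_apply, conjTranspose_apply, of_apply, Fintype.sum_sum_type,
      Sum.elim_inl, Sum.elim_inr, fromBlocks_apply₁₁, fromBlocks_apply₁₂, fromBlocks_apply₂₁,
      fromBlocks_apply₂₂, one_apply, mul_ite, mul_one, mul_zero, ite_mul, zero_mul, apply_ite star,
      star_zero, Finset.sum_ite_eq, Finset.mem_univ, if_true]
    ring
  ext u v
  rw [qubitImage, hrow, ← hφ, ← hφ, ← hφ, ← hφ]
  have hX : (of fun c d => vecMulVec (fun u : m × p => K u.1 0 * b 0 u.2 + K u.1 1 * b 1 u.2)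
      (star fun u => K u.1 0 * b 0 u.2 + K u.1 1 * b 1 u.2) (u.1, c) (v.1, d)) =
      (K u.1 0 * star (K v.1 0)) • vecMulVec (b 0) (star (b 0)) +
        (K u.1 0 * star (K v.1 1)) • vecMulVec (b 0) (star (b 1)) +
        (K u.1 1 * star (K v.1 0)) • vecMulVec (b 1) (star (b 0)) +
        (K u.1 1 * star (K v.1 1)) • vecMulVec (b 1) (star (b 1)) := by
    ext c d
    simp [vecMulVec_apply]
    ring
  change φ (of fun c d => vecMulVec (fun u : m × p => K u.1 0 * b 0 u.2 + K u.1 1 * b 1 u.2)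
      (star fun u => K u.1 0 * b 0 u.2 + K u.1 1 * b 1 u.2) (u.1, c) (v.1, d)) u.2 v.2 = _
  rw [hX]
  simp

theorem IsPPTMap.isSeparable_ampliation [Fintype m] [Fintype n] [Fintype p]
    {φ : Matrix p p ℂ →ₗ[ℂ] Matrix n n ℂ} (hφ : IsPPTMap φ) (hb : MapsIntoBlock 3 φ)
    {a : m × p → ℂ} (ha : schmidtRank a ≤ 2) :
    IsSeparable (ampliation φ (vecMulVec a (star a))) := by
  classical
  obtain ⟨K, L, hKL⟩ := exists_eq_mul_of_rank_le _ ha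
  obtain ⟨P, hP, hPr, hφP⟩ := hb
  obtain ⟨F, G, hFG⟩ := exists_eq_mul_of_rank_le P hPr
  have haKL : a = fun u => K u.1 0 * L 0 u.2 + K u.1 1 * L 1 u.2 := by
    funext u
    have := congrFun (congrFun hKL u.1) u.2
    simpa [mul_apply] using this
  have h1 := IsPPT.mem_sepCone 3 le_rfl _ ((hφ.isPPT_qubitImage L).map_localOp G)
  have h2 := isSeparable_of_mem_sepCone h1 K F
  rw [haKL, ampliation_vecMulVec_eq hP.isSelfAdjoint hφP K L, hFG, ← qubitKronecker_mul_localOp]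
  simpa only [conjTranspose_mul, Matrix.mul_assoc] using h2

theorem ampliation_sum {ι : Type*} [Fintype ι] {q : Type*}
    (φ : ι → Matrix p p ℂ →ₗ[ℂ] Matrix q q ℂ) (X : Matrix (k × p) (k × p) ℂ) :
    ampliation (∑ j, φ j) X = ∑ j, ampliation (φ j) X := by
  ext u v
  simp [ampliation, Matrix.sum_apply, LinearMap.sum_apply]

end PPTSquare

theorem theorem4 (n q p m : ℕ) (ι : Type*) [Fintype ι]
    (φ : Matrix (Fin p) (Fin p) ℂ →ₗ[ℂ] Matrix (Fin m) (Fin m) ℂ)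
    (φj : ι → Matrix (Fin p) (Fin p) ℂ →ₗ[ℂ] Matrix (Fin m) (Fin m) ℂ)
    (hφ : φ = ∑ j, φj j)
    (hPPT : ∀ j, PPTSquare.IsPPTMap (φj j))
    (hblock : ∀ j, PPTSquare.MapsIntoBlock 3 (φj j))
    (φ' : Matrix (Fin q) (Fin q) ℂ →ₗ[ℂ] Matrix (Fin p) (Fin p) ℂ)
    (hφ' : PPTSquare.IsPPTMap φ')
    (ρ : Matrix (Fin n × Fin q) (Fin n × Fin q) ℂ) (hρ : ρ.PosSemidef)
    (hSN : PPTSquare.SchmidtNumberLE 2 (PPTSquare.ampliation φ' ρ)) :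
    PPTSquare.IsSeparable (PPTSquare.ampliation (φ ∘ₗ φ') ρ) := by
  obtain ⟨N, a, ha, hσ⟩ := hSN
  have hcomp : PPTSquare.ampliation (φ ∘ₗ φ') ρ =
      PPTSquare.ampliation φ (PPTSquare.ampliation φ' ρ) := rfl
  rw [hcomp, hσ, hφ, PPTSquare.ampliation_sum]
  refine PPTSquare.IsSeparable.sum _ fun j => ?_
  rw [map_sum]
  exact PPTSquare.IsSeparable.sum _ fun i => (hPPT j).isSeparable_ampliation (hblock j) (ha i)
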